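/- Let $n\ge 1$ be an integer, let $\gamma(t,x)=\int_0^x s^{t-1}e^{-s}\,ds$ be the lower incomplete gamma function, let $\operatorname{erf}(t)=\frac{2}{\sqrt\pi}\int_0^t e^{-s^2}\,ds$, and let $\operatorname{erf}^{-1}\colon(-1,1)\to\mathbb{R}$ be the inverse of $\operatorname{erf}\colon\mathbb R\to(-1,1)$. Let $$\Phi_{\mathbb{R}^n}\colon(0,1)^n\to\mathbb{R}^n,\qquad \Phi_{\mathbb{R}^n}(x)=\big(\sqrt2\operatorname{erf}^{-1}(2x_1-1),\dots,\sqrt2\operatorname{erf}^{-1}(2x_n-1)\big),$$ and $$\exp_{\mathbb{S}^n}(v)=\Big(\frac{v}{\|v\|}\sin\|v\|,\ \cos\|v\|\Big)\in\mathbb{S}^n\subset\mathbb{R}^{n+1},\qquad v\in\mathbb{R}^n,$$ with the convention, here and below, that $v/\|v\|=0$ for $v=0$. Let $\mu_1$ be the standard normal distribution on $\mathbb{R}^n$, with density $(2\pi)^{-n/2}e^{-\|x\|^2/2}$, let $\mu_\omega$ be the measure on the open ball $B^n(0,\pi)$ with density $\omega(\|x\|)$, where $$\omega(s)=\frac{\Gamma(\frac{n+1}{2})}{2\pi^{(n+1)/2}}\,\frac{\sin^{n-1}s}{s^{n-1}},$$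 and let $\operatorname{unif}$ denote the uniform probability measure on $(0,1)^n$ (Lebesgue measure) and on $\mathbb{S}^n$ (normalized surface measure). A bijection between measure spaces is called measure preserving if it and its inverse are measurable and $\mu_2(A)=\mu_1(f^{-1}(A))$ for all measurable $A$. For every $r\ge 0$ there is a unique $\rho=\rho(r)\in[0,\pi)$ such that $$\int_0^{\rho}\sin^{n-1}t\,dt=\frac{\sqrt\pi}{\Gamma(\frac{n+1}{2})}\,\gamma\Big(\frac n2,\frac{r^2}{2}\Big).$$ With this function $\rho$, the mapping $\varphi_{\mathbb{S}^n}\colon(\mathbb{R}^n,\mu_1)\to(B^n(0,\pi),\mu_\omega)$, $\varphi_{\mathbb{S}^n}(x)=\rho(\|x\|)\,x/\|x\|$, is measure preserving. Consequently $$\Phi_{\mathbb{S}^n}=\exp_{\mathbb{S}^n}\circ\,\varphi_{\mathbb{S}^n}\circ\Phi_{\mathbb{R}^n}\colon((0,1)^n,\operatorname{unif})\to(\mathbb{S}^n,\operatorname{unif})$$ is measure preserving, as a bijection onto $\mathbb{S}^n$ minus the south pole $(0,\dots,0,-1)$, which is a set of measure zero. For $n=1$, for all $r\ge 0$ and $x\in(0,1)$,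 $$\rho(r)=\sqrt\pi\,\gamma\Big(\frac12,\frac{r^2}{2}\Big)=\pi\operatorname{erf}\Big(\frac{r}{\sqrt2}\Big),\qquad \Phi_{\mathbb{S}^1}(x)=(-\sin 2\pi x,\,-\cos 2\pi x),$$ and the latter point is $-ie^{-i2\pi x}$ under the identification $(a,b)\cong a+ib$. For $n=2$, for all $r\ge 0$ and $x\in(0,1)^2$, writing $y=\Phi_{\mathbb{R}^2}(x)$, $$\rho(r)=2\arccos e^{-r^2/4},\qquad \Phi_{\mathbb{S}^2}(x)=\Big(\frac{y}{\|y\|}\,2e^{-\|y\|^2/4}\sqrt{1-e^{-\|y\|^2/2}},\ 2e^{-\|y\|^2/2}-1\Big).$$ -/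

import Mathlib

open MeasureTheory Set

noncomputable section

/-- The lower incomplete gamma function `γ(t, x) = ∫₀ˣ s^(t-1) e^(-s) ds`. -/
def lowerIncompleteGamma (t x : ℝ) : ℝ :=
  ∫ s in (0 : ℝ)..x, s ^ (t - 1) * Real.exp (-s)

/-- The error function `erf t = (2/√π) ∫₀ᵗ e^(-s²) ds`. -/
def errorFunction (t : ℝ) : ℝ :=
  2 / Real.sqrt Real.pi * ∫ s in (0 : ℝ)..t, Real.exp (-s ^ 2)

/-- The inverse of `erf : ℝ → (-1, 1)` (only its values on `(-1, 1)` are meaningful). -/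
def errorFunctionInv : ℝ → ℝ := Function.invFun errorFunction

/-- A map `f : (α, μ) → (β, ν)` is a measure-preserving bijection of `α` onto the subset `T` of
full measure in `β`: it is bijective onto `T`, it and its inverse `T → α` are measurable, and
`ν B = μ (f⁻¹ B)` for every measurable `B`. -/
structure IsMeasurePreservingOnto {α β : Type*} [MeasurableSpace α] [MeasurableSpace β]
    (f : α → β) (μ : Measure α) (ν : Measure β) (T : Set β) : Prop where
  injective : Function.Injective f
  range_eq : Set.range f = T
  null_compl : ν Tᶜ = 0
  measurable : Measurable f
  measurableSet_image : ∀ A : Set α, MeasurableSet A → MeasurableSet (f '' A)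
  measure_preimage : ∀ B : Set β, MeasurableSet B → ν B = μ (f ⁻¹' B)

/-- The open unit cube `(0,1)ⁿ`. -/
def openCube (n : ℕ) : Set (EuclideanSpace ℝ (Fin n)) :=
  {x | ∀ i, x i ∈ Set.Ioo (0 : ℝ) 1}

/-- Lebesgue measure on the open unit cube, which is its uniform probability measure. -/
def cubeUniform (n : ℕ) : Measure (openCube n) :=
  Measure.comap Subtype.val (volume : Measure (EuclideanSpace ℝ (Fin n)))

/-- The normal distribution `𝒩(0, c)` on `ℝⁿ`, with density `(2πc)^(-n/2) e^(-‖x‖²/(2c))`. -/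
def normalMeasure (n : ℕ) (c : ℝ) : Measure (EuclideanSpace ℝ (Fin n)) :=
  volume.withDensity fun x =>
    ENNReal.ofReal (1 / (2 * Real.pi * c) ^ ((n : ℝ) / 2) * Real.exp (-‖x‖ ^ 2 / (2 * c)))

/-- The measure on the open ball `B(0, R)` with radial density `ω(‖x‖)`, regarded as a measure on
`ℝⁿ` concentrated on that ball. -/
def radialMeasure (n : ℕ) (R : ℝ) (ω : ℝ → ℝ) : Measure (EuclideanSpace ℝ (Fin n)) :=
  (volume.restrict (Metric.ball 0 R)).withDensity fun x => ENNReal.ofReal (ω ‖x‖)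

/-- The volume `2 π^((n+1)/2) / Γ((n+1)/2)` of the unit sphere `Sⁿ`. -/
def sphereVolume (n : ℕ) : ℝ :=
  2 * Real.pi ^ (((n : ℝ) + 1) / 2) / Real.Gamma (((n : ℝ) + 1) / 2)

/-- The volume density `Ω(r) = sinⁿ⁻¹ r / rⁿ⁻¹` of the unit sphere `Sⁿ`, for `n ≥ 1`. -/
def sphereVolumeDensity (n : ℕ) (r : ℝ) : ℝ :=
  Real.sin r ^ (n - 1) / r ^ (n - 1)

/-- The unit sphere `Sⁿ` in `ℝⁿ⁺¹`. -/
abbrev UnitSphere (n : ℕ) : Type := Metric.sphere (0 : EuclideanSpace ℝ (Fin (n + 1))) 1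

/-- The uniform probability measure on `Sⁿ`: the surface measure `volume.toSphere` induced by
Lebesgue measure on `ℝⁿ⁺¹`, divided by its total mass. -/
def sphereUniform (n : ℕ) : Measure (UnitSphere n) :=
  ((volume : Measure (EuclideanSpace ℝ (Fin (n + 1)))).toSphere Set.univ)⁻¹ •
    (volume : Measure (EuclideanSpace ℝ (Fin (n + 1)))).toSphere

/-- The map `(0,1)ⁿ → ℝⁿ`, `x ↦ (√2 erf⁻¹(2x₁ - 1), …, √2 erf⁻¹(2xₙ - 1))`. -/
def cubeToEuclidean (n : ℕ) (x : openCube n) : EuclideanSpace ℝ (Fin n) :=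
  WithLp.toLp 2 fun i => Real.sqrt 2 * errorFunctionInv (2 * (x : EuclideanSpace ℝ (Fin n)) i - 1)

/-- The radial map `x ↦ x ρ(‖x‖)/‖x‖`, with value `0` at `x = 0`. -/
def radialMap (n : ℕ) (ρ : ℝ → ℝ) (x : EuclideanSpace ℝ (Fin n)) : EuclideanSpace ℝ (Fin n) :=
  (ρ ‖x‖ / ‖x‖) • x

/-- The vector `((v/‖v‖) sin ‖v‖, cos ‖v‖)` of `ℝⁿ⁺¹`, which is the north pole for `v = 0`. -/
def sphereExpVec (n : ℕ) (v : EuclideanSpace ℝ (Fin n)) : EuclideanSpace ℝ (Fin (n + 1)) :=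
  WithLp.toLp 2 (Fin.snoc (α := fun _ => ℝ) (fun i : Fin n => v i / ‖v‖ * Real.sin ‖v‖)
    (Real.cos ‖v‖))

theorem sphereExpVec_mem_sphere (n : ℕ) (v : EuclideanSpace ℝ (Fin n)) :
    sphereExpVec n v ∈ Metric.sphere (0 : EuclideanSpace ℝ (Fin (n + 1))) 1 := by
  have hv : ∑ i, v i ^ 2 = ‖v‖ ^ 2 := by
    rw [EuclideanSpace.norm_sq_eq]
    simp
  have h : ‖sphereExpVec n v‖ ^ 2 = 1 := by
    rw [EuclideanSpace.norm_sq_eq, Fin.sum_univ_castSucc]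
    simp only [sphereExpVec, Fin.snoc_castSucc, Fin.snoc_last, Real.norm_eq_abs, sq_abs, mul_pow,
      div_pow]
    rw [← Finset.sum_mul, ← Finset.sum_div, hv]
    by_cases h0 : ‖v‖ = 0
    · simp [h0]
    · rw [div_self (pow_ne_zero 2 h0), one_mul, Real.sin_sq_add_cos_sq]
  rw [mem_sphere_zero_iff_norm]
  exact (sq_eq_sq₀ (norm_nonneg _) zero_le_one).1 (by rw [h, one_pow])

/-- The exponential map of `Sⁿ` based at the north pole `(0, …, 0, 1)`. -/
def sphereExp (n : ℕ) (v : EuclideanSpace ℝ (Fin n)) : UnitSphere n :=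
  ⟨sphereExpVec n v, sphereExpVec_mem_sphere n v⟩

/-- The south pole `(0, …, 0, -1)` of `Sⁿ`. -/
def southPole (n : ℕ) : UnitSphere n :=
  ⟨EuclideanSpace.single (Fin.last n) (-1), by simp⟩

/-- `s` solves the radial equation of `Sⁿ` at radius `r`:
`∫₀ˢ sinⁿ⁻¹ t dt = (√π / Γ((n+1)/2)) γ(n/2, r²/2)`, where `s ∈ [0, π)`. -/
def IsSphereRadius (n : ℕ) (r s : ℝ) : Prop :=
  s ∈ Set.Ico 0 Real.pi ∧
    ∫ t in (0 : ℝ)..s, Real.sin t ^ (n - 1) =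
      Real.sqrt Real.pi / Real.Gamma (((n : ℝ) + 1) / 2) *
        lowerIncompleteGamma ((n : ℝ) / 2) (r ^ 2 / 2)

/-- The composition `Φ = exp ∘ φ ∘ Φ_{ℝⁿ} : (0,1)ⁿ → Sⁿ`, where `φ(x) = x ρ(‖x‖)/‖x‖`. -/
def cubeToSphere (n : ℕ) (ρ : ℝ → ℝ) : openCube n → UnitSphere n :=
  sphereExp n ∘ radialMap n ρ ∘ cubeToEuclidean n

end

/-! In polar coordinates x = rθ on ℝⁿ the normal distribution and the measure on the ball both split
into the surface measure of Sⁿ⁻¹ and a radial density: up to constants, rⁿ⁻¹e^(-r²/2) for the former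
and sinⁿ⁻¹ s for the latter. A radial map keeps θ, so only a transport on the half line remains.
After the substitution s = t²/2 (`lowerIncompleteGamma_half_sq`), the equation for ρ says that the
two radial distribution functions agree at r and ρ(r), and this determines the image measure
(`map_sphereRadius`). The total masses agree by the Gamma-function value of ∫₀^π sinⁿ⁻¹
(`sinPowIntegral_pi`), so ρ is an increasing bijection from [0,∞) onto [0,π).

The exponential map carries the measure on the ball to the uniform measure because (s, θ) are
spherical coordinates about the north pole, with area element sinⁿ⁻¹ s ds dθ. These coordinates on
ℝⁿ⁺¹ arise from polar coordinates in the first n variables, followed by planar polar coordinates in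
the pair (last variable, radius) (`lintegral_sphericalCoord`). Computing the volume of the cone over
a subset of Sⁿ in two ways then gives its area (`toSphere_apply_eq_lintegral_sphereExp`).

On the cube, each coordinate passes through the quantile function of the standard normal law, and
the normal density is a product, so the image measure is the standard normal one
(`map_cubeToEuclidean`). The composition is injective with image the sphere without the south pole,
and measurability of the inverse is automatic between standard Borel spaces
(`isMeasurePreservingOnto_of_map`). For n = 1 and n = 2 the radial equation is solved by elementary
antiderivatives. -/

noncomputable section

/-! ### Spherical coordinates and the surface measure of the sphere -/

/-- Integration in polar coordinates. -/
theorem lintegral_eq_lintegral_toSphere {E : Type*} [NormedAddCommGroup E] [NormedSpace ℝ E]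
    [MeasurableSpace E] [BorelSpace E] [FiniteDimensional ℝ E] [Nontrivial E]
    (μ : Measure E) [μ.IsAddHaarMeasure] {f : E → ENNReal} (hf : Measurable f) :
    ∫⁻ x, f x ∂μ = ∫⁻ θ, ∫⁻ r in Ioi (0 : ℝ),
      ENNReal.ofReal (r ^ (Module.finrank ℝ E - 1)) * f (r • (θ : E)) ∂volume ∂μ.toSphere := by
  have h0 : ∫⁻ x, f x ∂μ = ∫⁻ x in ({0}ᶜ : Set E), f x ∂μ := by
    rw [restrict_compl_singleton]
  have hmp := μ.measurePreserving_homeomorphUnitSphereProd.symm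
    (homeomorphUnitSphereProd E).toMeasurableEquiv
  have hmeas : Measurable fun p : Metric.sphere (0 : E) 1 × Ioi (0 : ℝ) =>
      f (((homeomorphUnitSphereProd E).symm p : ({0}ᶜ : Set E)) : E) :=
    hf.comp (measurable_subtype_coe.comp (homeomorphUnitSphereProd E).symm.measurable)
  rw [h0, ← lintegral_subtype_comap (measurableSet_singleton _).compl,
    ← hmp.lintegral_comp (f := fun x : ({0}ᶜ : Set E) => f x) (hf.comp measurable_subtype_coe)]
  change ∫⁻ p, f (((homeomorphUnitSphereProd E).symm p : ({0}ᶜ : Set E)) : E) ∂_ = _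
  rw [lintegral_prod _ hmeas.aemeasurable]
  refine lintegral_congr fun θ => ?_
  rw [Measure.volumeIoiPow, lintegral_withDensity_eq_lintegral_mul _ (by fun_prop)
    (g := fun r => f (((homeomorphUnitSphereProd E).symm (θ, r) : ({0}ᶜ : Set E)) : E))
    (hmeas.comp measurable_prodMk_left)]
  simp only [Pi.mul_apply, homeomorphUnitSphereProd_symm_apply_coe]
  exact lintegral_subtype_comap measurableSet_Ioi
    (fun r : ℝ => ENNReal.ofReal (r ^ (Module.finrank ℝ E - 1)) * f (r • (θ : E)))

/-- The point of `ℝⁿ⁺¹` with first `n` coordinates `v` and last coordinate `z`. -/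
def euclideanSnoc (n : ℕ) (v : EuclideanSpace ℝ (Fin n)) (z : ℝ) :
    EuclideanSpace ℝ (Fin (n + 1)) :=
  WithLp.toLp 2 (Fin.snoc (α := fun _ => ℝ) (fun i : Fin n => v i) z)

theorem measurable_euclideanSnoc (n : ℕ) :
    Measurable fun p : EuclideanSpace ℝ (Fin n) × ℝ => euclideanSnoc n p.1 p.2 := by
  refine (WithLp.measurable_toLp 2 _).comp (measurable_pi_lambda _ fun i => ?_)
  refine Fin.lastCases ?_ (fun j => ?_) i
  · simpa using measurable_snd
  · simp only [Fin.snoc_castSucc]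
    fun_prop

theorem euclideanSnoc_smul (n : ℕ) (v : EuclideanSpace ℝ (Fin n)) (z c : ℝ) :
    euclideanSnoc n (c • v) (c * z) = c • euclideanSnoc n v z := by
  ext i
  refine Fin.lastCases ?_ (fun j => ?_) i <;> simp [euclideanSnoc]

theorem lintegral_euclideanSnoc (n : ℕ) {f : EuclideanSpace ℝ (Fin (n + 1)) → ENNReal}
    (hf : Measurable f) :
    ∫⁻ x, f x = ∫⁻ z : ℝ, ∫⁻ v, f (euclideanSnoc n v z) := by
  have h1 := (volume_preserving_piFinSuccAbove (fun _ : Fin (n + 1) => ℝ) (Fin.last n)).symm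
  have hc : Measurable fun p : EuclideanSpace ℝ (Fin n) × ℝ => f (euclideanSnoc n p.1 p.2) :=
    hf.comp (measurable_euclideanSnoc n)
  have hfL : Measurable fun y : Fin (n + 1) → ℝ => f (WithLp.toLp 2 y) :=
    hf.comp (WithLp.measurable_toLp 2 _)
  rw [← (PiLp.volume_preserving_toLp (Fin (n + 1))).lintegral_comp hf, ← h1.lintegral_comp hfL,
    Measure.volume_eq_prod,
    lintegral_prod (fun p => f (WithLp.toLp 2
      ((MeasurableEquiv.piFinSuccAbove (fun _ => ℝ) (Fin.last n)).symm p)))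
    (hfL.comp (MeasurableEquiv.measurable _)).aemeasurable]
  refine lintegral_congr fun z => ?_
  rw [← (PiLp.volume_preserving_toLp (Fin n)).lintegral_comp
    (f := fun v => f (euclideanSnoc n v z)) (hc.comp (measurable_id.prodMk measurable_const))]
  refine lintegral_congr fun v => ?_
  simp [euclideanSnoc, MeasurableEquiv.piFinSuccAbove, Fin.insertNthEquiv, Fin.insertNth_last']

theorem sphereExpVec_smul_sphere (n : ℕ) {θ : EuclideanSpace ℝ (Fin n)} (hθ : ‖θ‖ = 1) {s : ℝ}
    (hs : 0 < s) : sphereExpVec n (s • θ) = euclideanSnoc n (Real.sin s • θ) (Real.cos s) := by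
  have : ‖s • θ‖ = s := by rw [norm_smul, hθ, mul_one, Real.norm_of_nonneg hs.le]
  ext i
  refine Fin.lastCases ?_ (fun j => ?_) i
  · simp [euclideanSnoc, sphereExpVec, this]
  · simp [euclideanSnoc, sphereExpVec, this]
    field_simp

theorem measurable_sphereExp (n : ℕ) : Measurable (sphereExp n) := by
  refine Measurable.subtype_mk ?_
  refine (WithLp.measurable_toLp 2 _).comp (measurable_pi_lambda _ fun i => ?_)
  refine Fin.lastCases ?_ (fun j => ?_) i
  · simp only [Fin.snoc_last]
    fun_prop
  · simp only [Fin.snoc_castSucc]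
    fun_prop

/-- Integration in polar coordinates on the upper half plane. -/
theorem lintegral_halfPlane_polar {g : ℝ × ℝ → ENNReal} (hg : Measurable g) :
    ∫⁻ z : ℝ, ∫⁻ r in Ioi (0 : ℝ), g (z, r) =
      ∫⁻ s in Ioo 0 Real.pi, ∫⁻ R in Ioi (0 : ℝ),
        ENNReal.ofReal R * g (R * Real.cos s, R * Real.sin s) := by
  set T : Set (ℝ × ℝ) := univ ×ˢ Ioi 0 with hT
  have hTm : MeasurableSet T := MeasurableSet.univ.prod measurableSet_Ioi
  have h1 : ∫⁻ z : ℝ, ∫⁻ r in Ioi (0 : ℝ), g (z, r) = ∫⁻ p, T.indicator g p := by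
    rw [lintegral_indicator hTm, hT, Measure.volume_eq_prod, ← Measure.prod_restrict,
      Measure.restrict_univ, lintegral_prod _ hg.aemeasurable]
  have h2 : Measurable fun p : ℝ × ℝ =>
      ENNReal.ofReal p.1 * g (p.1 * Real.cos p.2, p.1 * Real.sin p.2) := by fun_prop
  rw [h1, ← lintegral_comp_polarCoord_symm]
  -- The polar chart uses angles in (-π, π). The angle is measured from the first axis, so the half
  -- plane of positive second coordinate is exactly the sector 0 < s < π.
  have h3 : ∫⁻ p in polarCoord.target,
        ENNReal.ofReal p.1 • T.indicator g (polarCoord.symm p) =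
      ∫⁻ p in Ioi (0 : ℝ) ×ˢ Ioo (0 : ℝ) Real.pi,
        ENNReal.ofReal p.1 * g (p.1 * Real.cos p.2, p.1 * Real.sin p.2) := by
    rw [← lintegral_indicator polarCoord.open_target.measurableSet,
      ← lintegral_indicator (measurableSet_Ioi.prod measurableSet_Ioo)]
    refine lintegral_congr fun p => ?_
    obtain ⟨R, s⟩ := p
    by_cases hR : 0 < R
    · by_cases hs : s ∈ Ioo (0 : ℝ) Real.pi
      · have a1 : (R, s) ∈ polarCoord.target :=
          ⟨hR, by linarith [hs.1, hs.2, Real.pi_pos], hs.2⟩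
        have a2 : (R, s) ∈ Ioi (0 : ℝ) ×ˢ Ioo (0 : ℝ) Real.pi := ⟨hR, hs⟩
        have a3 : polarCoord.symm (R, s) ∈ T :=
          ⟨trivial, mul_pos hR (Real.sin_pos_of_mem_Ioo hs)⟩
        rw [indicator_of_mem a1, indicator_of_mem a2, indicator_of_mem a3]
        rfl
      · have a2 : (R, s) ∉ Ioi (0 : ℝ) ×ˢ Ioo (0 : ℝ) Real.pi := fun h => hs h.2
        rw [indicator_of_notMem a2]
        by_cases a1 : (R, s) ∈ polarCoord.target
        · have a3 : polarCoord.symm (R, s) ∉ T := by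
            rintro ⟨-, h⟩
            have h' : 0 < R * Real.sin s := h
            obtain ⟨-, hs1, hs2⟩ := a1
            have : s ≤ 0 := by
              by_contra h4
              exact hs ⟨not_le.1 h4, hs2⟩
            have := Real.sin_nonpos_of_nonpos_of_neg_pi_le this hs1.le
            nlinarith
          rw [indicator_of_mem a1, indicator_of_notMem a3, smul_zero]
        · rw [indicator_of_notMem a1]
    · rw [indicator_of_notMem (fun h => hR h.1), indicator_of_notMem (fun h => hR h.1)]
  rw [h3, Measure.volume_eq_prod, ← Measure.prod_restrict,
    lintegral_prod_symm _ h2.aemeasurable]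

/-- Integration over `ℝⁿ⁺¹` in spherical coordinates based at the north pole. -/
theorem lintegral_sphericalCoord {n : ℕ} (hn : 1 ≤ n)
    {f : EuclideanSpace ℝ (Fin (n + 1)) → ENNReal} (hf : Measurable f) :
    ∫⁻ x, f x = ∫⁻ θ, ∫⁻ s in Ioo 0 Real.pi, ENNReal.ofReal (Real.sin s ^ (n - 1)) *
        (∫⁻ R in Ioi (0 : ℝ), ENNReal.ofReal (R ^ n) * f (R • sphereExpVec n (s • θ.1)))
      ∂volume ∂(volume : Measure (EuclideanSpace ℝ (Fin n))).toSphere := by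
  have : Nonempty (Fin n) := ⟨⟨0, hn⟩⟩
  have hc : Measurable fun p : EuclideanSpace ℝ (Fin n) × ℝ => f (euclideanSnoc n p.1 p.2) :=
    hf.comp (measurable_euclideanSnoc n)
  have hj : Measurable fun p : (ℝ × ℝ) × Metric.sphere (0 : EuclideanSpace ℝ (Fin n)) 1 =>
      ENNReal.ofReal (p.1.2 ^ (n - 1)) * f (euclideanSnoc n (p.1.2 • p.2.1) p.1.1) := by
    refine Measurable.mul (by fun_prop) (hc.comp (Measurable.prodMk ?_ (by fun_prop)))
    fun_prop
  have h1 : ∀ z : ℝ, ∫⁻ v, f (euclideanSnoc n v z) =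
      ∫⁻ θ, ∫⁻ r in Ioi (0 : ℝ), ENNReal.ofReal (r ^ (n - 1)) * f (euclideanSnoc n (r • θ.1) z)
        ∂volume ∂(volume : Measure (EuclideanSpace ℝ (Fin n))).toSphere := by
    intro z
    rw [lintegral_eq_lintegral_toSphere volume (f := fun v => f (euclideanSnoc n v z))
      (hc.comp (measurable_id.prodMk measurable_const)), finrank_euclideanSpace_fin]
  rw [lintegral_euclideanSnoc n hf]
  simp_rw [h1]
  -- With θ fixed, the remaining variables (z, r) range over a half plane, where planar polar
  -- coordinates apply.
  rw [lintegral_lintegral_swap]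
  · refine lintegral_congr fun θ => ?_
    rw [lintegral_halfPlane_polar (g := fun p : ℝ × ℝ =>
      ENNReal.ofReal (p.2 ^ (n - 1)) * f (euclideanSnoc n (p.2 • θ.1) p.1))
      (hj.comp (g := fun p : (ℝ × ℝ) × Metric.sphere (0 : EuclideanSpace ℝ (Fin n)) 1 =>
      ENNReal.ofReal (p.1.2 ^ (n - 1)) * f (euclideanSnoc n (p.1.2 • p.2.1) p.1.1))
      (measurable_id.prodMk measurable_const))]
    refine setLIntegral_congr_fun measurableSet_Ioo fun s hs => ?_
    rw [← lintegral_const_mul' _ _ ENNReal.ofReal_ne_top]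
    refine setLIntegral_congr_fun measurableSet_Ioi fun R hR => ?_
    simp only
    have hθ : ‖θ.1‖ = 1 := mem_sphere_zero_iff_norm.1 θ.2
    have hR0 : (0 : ℝ) ≤ R := le_of_lt hR
    have hs0 := Real.sin_nonneg_of_mem_Icc (Ioo_subset_Icc_self hs)
    rw [sphereExpVec_smul_sphere n hθ hs.1, ← euclideanSnoc_smul, smul_smul, ← mul_assoc,
      ← mul_assoc, ← ENNReal.ofReal_mul hR0, ← ENNReal.ofReal_mul (by positivity)]
    congr 2
    -- The planar Jacobian R joins the weight (R sin s)ⁿ⁻¹, giving Rⁿ sinⁿ⁻¹ s.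
    rw [mul_pow, ← mul_assoc, ← pow_succ', Nat.sub_add_cancel hn, mul_comm]
  · refine Measurable.aemeasurable ?_
    refine Measurable.lintegral_prod_right'
      (f := fun q : (ℝ × Metric.sphere (0 : EuclideanSpace ℝ (Fin n)) 1) × ℝ =>
        ENNReal.ofReal (q.2 ^ (n - 1)) * f (euclideanSnoc n (q.2 • q.1.2.1) q.1.1)) ?_
    exact hj.comp (g := fun p : (ℝ × ℝ) × Metric.sphere (0 : EuclideanSpace ℝ (Fin n)) 1 =>
      ENNReal.ofReal (p.1.2 ^ (n - 1)) * f (euclideanSnoc n (p.1.2 • p.2.1) p.1.1))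
      (f := fun q : (ℝ × Metric.sphere (0 : EuclideanSpace ℝ (Fin n)) 1) × ℝ =>
        ((q.1.1, q.2), q.1.2)) (by fun_prop)

/-- The surface measure of the sphere in polar coordinates about the north pole. -/
theorem toSphere_apply_eq_lintegral_sphereExp {n : ℕ} (hn : 1 ≤ n) {A : Set (UnitSphere n)}
    (hA : MeasurableSet A) :
    (volume : Measure (EuclideanSpace ℝ (Fin (n + 1)))).toSphere A =
      ∫⁻ θ, ∫⁻ s in Ioo 0 Real.pi, ENNReal.ofReal (Real.sin s ^ (n - 1)) *
        A.indicator 1 (sphereExp n (s • θ.1))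
      ∂volume ∂(volume : Measure (EuclideanSpace ℝ (Fin n))).toSphere := by
  set A' : Set (EuclideanSpace ℝ (Fin (n + 1))) := Subtype.val '' A
  have hA' : MeasurableSet A' := Metric.isClosed_sphere.measurableSet.subtype_image hA
  -- The test function is the indicator of the cone over `A` inside the unit ball. Its integral is
  -- evaluated once in ordinary polar coordinates and once in spherical coordinates about the pole.
  set f : EuclideanSpace ℝ (Fin (n + 1)) → ENNReal := fun x =>
    (Metric.ball 0 1).indicator 1 x * A'.indicator 1 (‖x‖⁻¹ • x) with hf_def
  have hf : Measurable f :=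
    (measurable_one.indicator measurableSet_ball).mul
      ((measurable_one.indicator hA').comp (by fun_prop))
  have hind : ∀ ω : UnitSphere n, A'.indicator (1 : EuclideanSpace ℝ (Fin (n + 1)) → ENNReal) ω.1 =
      A.indicator 1 ω := by
    intro ω
    by_cases h : ω ∈ A
    · rw [indicator_of_mem h, indicator_of_mem (mem_image_of_mem _ h)]; rfl
    · rw [indicator_of_notMem h, indicator_of_notMem]
      rintro ⟨ω', h', e⟩
      exact h (Subtype.ext e ▸ h')
  have hfR : ∀ ω : UnitSphere n, ∀ R ∈ Ioi (0 : ℝ), ENNReal.ofReal (R ^ n) * f (R • ω.1) =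
      A.indicator 1 ω * (Iio (1 : ℝ)).indicator (fun R => ENNReal.ofReal (R ^ n)) R := by
    intro ω R hR
    have hω : ‖ω.1‖ = 1 := mem_sphere_zero_iff_norm.1 ω.2
    have hn' : ‖R • ω.1‖ = R := by rw [norm_smul, hω, mul_one, Real.norm_of_nonneg (le_of_lt hR)]
    have : (R⁻¹ * R) = 1 := inv_mul_cancel₀ (ne_of_gt hR)
    simp only [hf_def, hn', smul_smul, this, one_smul]
    rw [hind ω]
    by_cases h1 : R < 1
    · have : R • ω.1 ∈ Metric.ball (0 : EuclideanSpace ℝ (Fin (n + 1))) 1 := by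
        rwa [mem_ball_zero_iff, hn']
      rw [indicator_of_mem this, indicator_of_mem (show R ∈ Iio (1 : ℝ) from h1), Pi.one_apply,
        one_mul, mul_comm]
    · have : R • ω.1 ∉ Metric.ball (0 : EuclideanSpace ℝ (Fin (n + 1))) 1 := by
        rwa [mem_ball_zero_iff, hn']
      rw [indicator_of_notMem this, indicator_of_notMem (show R ∉ Iio (1 : ℝ) from h1), zero_mul,
        mul_zero, mul_zero]
  -- Both evaluations contain this same radial factor, equal to 1/(n+1); being neither 0 nor ∞, it
  -- can be cancelled.
  set c : ENNReal := ∫⁻ R in Ioi (0 : ℝ), (Iio (1 : ℝ)).indicator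
    (fun R => ENNReal.ofReal (R ^ n)) R with hc_def
  have hinner : ∀ ω : UnitSphere n,
      ∫⁻ R in Ioi (0 : ℝ), ENNReal.ofReal (R ^ n) * f (R • ω.1) = A.indicator 1 ω * c := by
    intro ω
    rw [setLIntegral_congr_fun measurableSet_Ioi (hfR ω), lintegral_const_mul]
    exact Measurable.indicator (by fun_prop) measurableSet_Iio
  have hc : c = ENNReal.ofReal (1 / (n + 1)) := by
    rw [hc_def, lintegral_indicator measurableSet_Iio, Measure.restrict_restrict measurableSet_Iio,
      inter_comm, Ioi_inter_Iio, restrict_Ioo_eq_restrict_Ioc,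
      ← ofReal_integral_eq_lintegral_ofReal, ← intervalIntegral.integral_of_le zero_le_one]
    · simp
    · exact (intervalIntegral.intervalIntegrable_pow n).1
    · filter_upwards [ae_restrict_mem measurableSet_Ioc] with y hy
      exact pow_nonneg hy.1.le _
  have hc0 : c ≠ 0 := by
    rw [hc]
    exact (ENNReal.ofReal_pos.2 (by positivity)).ne'
  have hct : c ≠ ⊤ := by rw [hc]; exact ENNReal.ofReal_ne_top
  have e1 := lintegral_eq_lintegral_toSphere
    (volume : Measure (EuclideanSpace ℝ (Fin (n + 1)))) hf
  have e2 := lintegral_sphericalCoord hn hf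
  simp only [finrank_euclideanSpace_fin, Nat.add_sub_cancel] at e1
  have hexp : ∀ v, sphereExpVec n v = (sphereExp n v).1 := fun _ => rfl
  simp_rw [hexp, hinner] at e2
  simp_rw [hinner] at e1
  rw [lintegral_mul_const' _ _ hct, lintegral_indicator_one hA] at e1
  simp_rw [← mul_assoc] at e2
  rw [← ENNReal.mul_left_inj hc0 hct, ← e1, e2, ← lintegral_mul_const' _ _ hct]
  simp_rw [lintegral_mul_const' _ _ hct]

/-! ### The radial equation and its solution -/

/-- `∫₀ʳ tⁿ⁻¹ e^(-t²/2) dt`. -/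
def radialGaussianIntegral (n : ℕ) (r : ℝ) : ℝ :=
  ∫ t in (0 : ℝ)..r, t ^ (n - 1) * Real.exp (-t ^ 2 / 2)

/-- `∫₀ˢ sinⁿ⁻¹ t dt`. -/
def sinPowIntegral (n : ℕ) (s : ℝ) : ℝ :=
  ∫ t in (0 : ℝ)..s, Real.sin t ^ (n - 1)

/-- The substitution s = t²/2 exposes the radial density of the normal distribution inside the
incomplete gamma function. -/
theorem lowerIncompleteGamma_half_sq {n : ℕ} (hn : 1 ≤ n) {r : ℝ} (hr : 0 ≤ r) :
    lowerIncompleteGamma ((n : ℝ) / 2) (r ^ 2 / 2) =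
      2 ^ (1 - (n : ℝ) / 2) * radialGaussianIntegral n r := by
  have hn0 : (0 : ℝ) < n := by exact_mod_cast hn
  have key : ∀ x : ℝ, 0 < x → ((fun s : ℝ => s ^ ((n : ℝ) / 2 - 1) * Real.exp (-s)) ∘
      fun t : ℝ => t ^ 2 / 2) x * x =
        2 ^ (1 - (n : ℝ) / 2) * (x ^ (n - 1) * Real.exp (-x ^ 2 / 2)) := by
    intro x hx
    have e1 : (x ^ 2 / 2) ^ ((n : ℝ) / 2 - 1) =
        x ^ ((n : ℝ) - 2) * 2 ^ (1 - (n : ℝ) / 2) := by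
      rw [Real.div_rpow (by positivity) (by norm_num), ← Real.rpow_natCast x 2,
        ← Real.rpow_mul hx.le, div_eq_mul_inv, ← Real.rpow_neg (by norm_num)]
      congr 2
      · push_cast; ring
      · ring
    have e2 : x ^ ((n : ℝ) - 2) * x = x ^ (n - 1) := by
      rw [← Real.rpow_natCast x (n - 1), Nat.cast_sub hn]
      nth_rewrite 2 [← Real.rpow_one x]
      rw [← Real.rpow_add hx]
      congr 1
      push_cast; ring
    simp only [Function.comp, e1]
    rw [← e2, neg_div]
    ring
  have hcont : Continuous fun x : ℝ => 2 ^ (1 - (n : ℝ) / 2) *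
      (x ^ (n - 1) * Real.exp (-x ^ 2 / 2)) := by fun_prop
  -- For n = 1 the integrand s^(-1/2)e^(-s) is singular at 0, so this form of the substitution rule
  -- is used: it asks for continuity of the integrand only on the image of the open interval, plus
  -- integrability.
  have h := intervalIntegral.integral_comp_mul_deriv''' (a := 0) (b := r)
    (f := fun t : ℝ => t ^ 2 / 2) (f' := fun t => t)
    (g := fun s : ℝ => s ^ ((n : ℝ) / 2 - 1) * Real.exp (-s)) (by fun_prop) ?_ ?_ ?_ ?_
  · simp only [ne_eq, OfNat.ofNat_ne_zero, not_false_eq_true, zero_pow, zero_div] at h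
    rw [lowerIncompleteGamma, ← h, radialGaussianIntegral,
      ← intervalIntegral.integral_const_mul]
    refine intervalIntegral.integral_congr_ae (Filter.Eventually.of_forall fun x hx => ?_)
    rw [uIoc_of_le hr] at hx
    exact key x hx.1
  · intro x _
    have := ((hasDerivAt_pow 2 x).div_const 2).hasDerivWithinAt (s := Ioi x)
    simpa using this
  · rintro _ ⟨x, hx, rfl⟩
    rw [min_eq_left hr] at hx
    have : x ^ 2 / 2 ≠ 0 := by have := hx.1; positivity
    refine ContinuousAt.continuousWithinAt ?_
    exact (Real.continuousAt_rpow_const _ _ (Or.inl this)).mul (by fun_prop)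
  · have hG := Real.GammaIntegral_convergent (s := (n : ℝ) / 2) (by positivity)
    rw [← integrableOn_Ici_iff_integrableOn_Ioi] at hG
    refine (hG.congr_fun (fun x _ => mul_comm _ _) measurableSet_Ici).mono_set ?_
    rintro _ ⟨x, -, rfl⟩
    exact div_nonneg (sq_nonneg x) zero_le_two
  · rw [uIcc_of_le hr, integrableOn_Icc_iff_integrableOn_Ioc]
    exact (hcont.integrableOn_Ioc).congr_fun (fun x hx => (key x hx.1).symm) measurableSet_Ioc

theorem integrableOn_radialGaussian (n : ℕ) :
    IntegrableOn (fun t : ℝ => t ^ (n - 1) * Real.exp (-t ^ 2 / 2)) (Ioi 0) := by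
  refine (integrableOn_rpow_mul_exp_neg_mul_rpow (p := 2) (s := ((n - 1 : ℕ) : ℝ)) (b := 1 / 2)
    (lt_of_lt_of_le (by norm_num) (Nat.cast_nonneg _)) (by norm_num) (by norm_num)).congr_fun
    (fun x _ => ?_) measurableSet_Ioi
  simp only [Real.rpow_natCast, Real.rpow_two]
  congr 2
  ring

theorem integral_radialGaussian_Ioi {n : ℕ} (hn : 1 ≤ n) :
    ∫ t in Ioi (0 : ℝ), t ^ (n - 1) * Real.exp (-t ^ 2 / 2) =
      2 ^ ((n : ℝ) / 2 - 1) * Real.Gamma ((n : ℝ) / 2) := by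
  have h := integral_rpow_mul_exp_neg_mul_rpow (p := 2) (q := ((n - 1 : ℕ) : ℝ)) (b := 1 / 2)
    (by norm_num) (lt_of_lt_of_le (by norm_num) (Nat.cast_nonneg _)) (by norm_num)
  have e : ((n - 1 : ℕ) : ℝ) + 1 = n := by
    rw [Nat.cast_sub hn]; push_cast; ring
  rw [e] at h
  have h2 : ∀ x : ℝ, x ^ (n - 1) * Real.exp (-x ^ 2 / 2) =
      x ^ ((n - 1 : ℕ) : ℝ) * Real.exp (-(1 / 2) * x ^ (2 : ℝ)) := by
    intro x
    simp only [Real.rpow_natCast, Real.rpow_two]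
    congr 2
    ring
  simp_rw [h2]
  rw [h, one_div, Real.inv_rpow (by norm_num), ← Real.rpow_neg (by norm_num),
    Real.rpow_sub (by norm_num), Real.rpow_one, neg_div, neg_neg]
  ring

/-- Both sides obey the same two-step recursion with factor (m+1)/(m+2): the left by the reduction
formula, the right by Γ(x+1) = xΓ(x). -/
theorem integral_sin_pow_zero_pi (m : ℕ) :
    ∫ t in (0 : ℝ)..Real.pi, Real.sin t ^ m =
      Real.sqrt Real.pi * Real.Gamma (((m : ℝ) + 1) / 2) / Real.Gamma (((m : ℝ) + 2) / 2) := by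
  induction m using Nat.twoStepInduction with
  | zero =>
    have : Real.sqrt Real.pi * Real.sqrt Real.pi = Real.pi := Real.mul_self_sqrt Real.pi_pos.le
    simp [Real.Gamma_one_half_eq, Real.Gamma_one, -one_div, this]
  | one =>
    have h : Real.Gamma ((1 + 2) / 2) = 1 / 2 * Real.sqrt Real.pi := by
      rw [show ((1 : ℝ) + 2) / 2 = 1 / 2 + 1 by norm_num, Real.Gamma_add_one (by norm_num),
        Real.Gamma_one_half_eq]
    have h0 : Real.sqrt Real.pi ≠ 0 := (Real.sqrt_pos.2 Real.pi_pos).ne'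
    rw [Nat.cast_one, h, show ((1 : ℝ) + 1) / 2 = 1 by norm_num, Real.Gamma_one]
    simp only [pow_one, integral_sin, Real.cos_zero, Real.cos_pi]
    field_simp
    norm_num
  | more m ih _ =>
    have h1 : Real.Gamma ((((m + 2 : ℕ) : ℝ) + 1) / 2) =
        ((m : ℝ) + 1) / 2 * Real.Gamma (((m : ℝ) + 1) / 2) := by
      rw [← Real.Gamma_add_one (by positivity)]
      congr 1; push_cast; ring
    have h2 : Real.Gamma ((((m + 2 : ℕ) : ℝ) + 2) / 2) =
        ((m : ℝ) + 2) / 2 * Real.Gamma (((m : ℝ) + 2) / 2) := by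
      rw [← Real.Gamma_add_one (by positivity)]
      congr 1; push_cast; ring
    have h3 : Real.Gamma (((m : ℝ) + 2) / 2) ≠ 0 := (Real.Gamma_pos_of_pos (by positivity)).ne'
    have h4 : (m : ℝ) + 2 ≠ 0 := by positivity
    rw [integral_sin_pow, ih, h1, h2]
    simp only [Real.sin_zero, Real.sin_pi, ne_eq, Nat.add_eq_zero_iff, one_ne_zero, and_false,
      not_false_eq_true, zero_pow, zero_mul, sub_self, zero_div, zero_add]
    field_simp

/-- The factor relating the two sides of the radial equation. -/
def radialFactor (n : ℕ) : ℝ :=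
  Real.sqrt Real.pi / Real.Gamma (((n : ℝ) + 1) / 2) * 2 ^ (1 - (n : ℝ) / 2)

theorem radialFactor_pos (n : ℕ) : 0 < radialFactor n := by
  have := Real.Gamma_pos_of_pos (show (0 : ℝ) < ((n : ℝ) + 1) / 2 by positivity)
  have := Real.sqrt_pos.2 Real.pi_pos
  unfold radialFactor
  positivity

theorem isSphereRadius_iff {n : ℕ} (hn : 1 ≤ n) {r : ℝ} (hr : 0 ≤ r) (s : ℝ) :
    IsSphereRadius n r s ↔ s ∈ Ico 0 Real.pi ∧
      sinPowIntegral n s = radialFactor n * radialGaussianIntegral n r := by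
  rw [IsSphereRadius, lowerIncompleteGamma_half_sq hn hr, radialFactor, mul_assoc, sinPowIntegral]

/-- The total radial masses match. Hence radius ∞ corresponds to the angle π of the south pole,
which no finite radius attains. -/
theorem sinPowIntegral_pi {n : ℕ} (hn : 1 ≤ n) : sinPowIntegral n Real.pi =
    radialFactor n * ∫ t in Ioi (0 : ℝ), t ^ (n - 1) * Real.exp (-t ^ 2 / 2) := by
  rw [sinPowIntegral, integral_sin_pow_zero_pi, integral_radialGaussian_Ioi hn, radialFactor,
    Nat.cast_sub hn]
  have e : (2 : ℝ) ^ (1 - (n : ℝ) / 2) * 2 ^ ((n : ℝ) / 2 - 1) = 1 := by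
    rw [← Real.rpow_add (by norm_num)]
    simp
  have e1 : ((n : ℝ) - (1 : ℕ) + 1) / 2 = n / 2 := by push_cast; ring
  have e2 : ((n : ℝ) - (1 : ℕ) + 2) / 2 = (n + 1) / 2 := by push_cast; ring
  rw [e1, e2]
  linear_combination (-Real.sqrt Real.pi * Real.Gamma ((n : ℝ) / 2) /
    Real.Gamma (((n : ℝ) + 1) / 2)) * e

/-- Positivity is required only in the open interval because powers of the sine may vanish at 0 and
π. -/
theorem strictMonoOn_primitive {f : ℝ → ℝ} (hf : Continuous f) {b : ℝ}
    (hpos : ∀ x ∈ Ioo 0 b, 0 < f x) : StrictMonoOn (fun x => ∫ t in (0 : ℝ)..x, f t) (Icc 0 b) := by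
  intro x hx y hy hxy
  have h : 0 < ∫ t in x..y, f t := by
    refine intervalIntegral.intervalIntegral_pos_of_pos_on (hf.intervalIntegrable _ _)
      (fun t ht => hpos t ⟨hx.1.trans_lt ht.1, ht.2.trans_le hy.2⟩) hxy
  have := intervalIntegral.integral_add_adjacent_intervals (hf.intervalIntegrable 0 x)
    (hf.intervalIntegrable (μ := volume) x y)
  simp only
  linarith

theorem strictMonoOn_sinPowIntegral (n : ℕ) :
    StrictMonoOn (sinPowIntegral n) (Icc 0 Real.pi) :=
  strictMonoOn_primitive (by fun_prop) fun _ hx => pow_pos (Real.sin_pos_of_mem_Ioo hx) _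

theorem continuous_sinPowIntegral (n : ℕ) : Continuous (sinPowIntegral n) :=
  intervalIntegral.continuous_primitive
    (fun _ _ => Continuous.intervalIntegrable (by fun_prop) _ _) 0

theorem continuous_radialGaussianIntegral (n : ℕ) : Continuous (radialGaussianIntegral n) :=
  intervalIntegral.continuous_primitive
    (fun _ _ => Continuous.intervalIntegrable (by fun_prop) _ _) 0

theorem strictMonoOn_radialGaussianIntegral (n : ℕ) :
    StrictMonoOn (radialGaussianIntegral n) (Ici 0) := by
  intro x hx y hy hxy
  exact strictMonoOn_primitive (b := y) (by fun_prop)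
    (fun t ht => mul_pos (pow_pos ht.1 _) (Real.exp_pos _)) ⟨hx, hxy.le⟩ ⟨hy, le_rfl⟩ hxy

@[simp] theorem sinPowIntegral_zero (n : ℕ) : sinPowIntegral n 0 = 0 :=
  intervalIntegral.integral_same

@[simp] theorem radialGaussianIntegral_zero (n : ℕ) : radialGaussianIntegral n 0 = 0 :=
  intervalIntegral.integral_same

theorem tendsto_radialGaussianIntegral (n : ℕ) :
    Filter.Tendsto (radialGaussianIntegral n) Filter.atTop
      (nhds (∫ t in Ioi (0 : ℝ), t ^ (n - 1) * Real.exp (-t ^ 2 / 2))) :=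
  intervalIntegral_tendsto_integral_Ioi 0 (integrableOn_radialGaussian n) Filter.tendsto_id

theorem radialGaussianIntegral_lt (n : ℕ) {r : ℝ} (hr : 0 ≤ r) :
    radialGaussianIntegral n r < ∫ t in Ioi (0 : ℝ), t ^ (n - 1) * Real.exp (-t ^ 2 / 2) := by
  refine (strictMonoOn_radialGaussianIntegral n hr (show (0 : ℝ) ≤ r + 1 by linarith)
    (lt_add_one r)).trans_le ?_
  refine ge_of_tendsto (tendsto_radialGaussianIntegral n) ?_
  filter_upwards [Filter.eventually_ge_atTop (r + 1)] with x hx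
  exact (strictMonoOn_radialGaussianIntegral n).monotoneOn (show (0 : ℝ) ≤ r + 1 by linarith)
    (show (0 : ℝ) ≤ x by linarith) hx

theorem existsUnique_isSphereRadius {n : ℕ} (hn : 1 ≤ n) {r : ℝ} (hr : 0 ≤ r) :
    ∃! s : ℝ, IsSphereRadius n r s := by
  have hK := radialFactor_pos n
  have h0 : 0 ≤ radialGaussianIntegral n r := by
    simpa using (strictMonoOn_radialGaussianIntegral n).monotoneOn
      (self_mem_Ici (a := (0 : ℝ))) hr hr
  have hlt : radialFactor n * radialGaussianIntegral n r < sinPowIntegral n Real.pi := by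
    rw [sinPowIntegral_pi hn]
    exact mul_lt_mul_of_pos_left (radialGaussianIntegral_lt n hr) hK
  obtain ⟨s, hs, hs'⟩ := intermediate_value_Ico Real.pi_pos.le
    (continuous_sinPowIntegral n).continuousOn
    (show radialFactor n * radialGaussianIntegral n r ∈ Ico _ _ from
      ⟨by rw [sinPowIntegral_zero]; positivity, hlt⟩)
  refine ⟨s, (isSphereRadius_iff hn hr s).2 ⟨hs, hs'⟩, fun t ht => ?_⟩
  obtain ⟨ht1, ht2⟩ := (isSphereRadius_iff hn hr t).1 ht
  exact (strictMonoOn_sinPowIntegral n).injOn (Ico_subset_Icc_self ht1)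
    (Ico_subset_Icc_self hs) (ht2.trans hs'.symm)

theorem strictMonoOn_sphereRadius {n : ℕ} (hn : 1 ≤ n) {ρ : ℝ → ℝ}
    (hρ : ∀ r : ℝ, 0 ≤ r → IsSphereRadius n r (ρ r)) : StrictMonoOn ρ (Ici 0) := by
  intro x hx y hy hxy
  obtain ⟨hx1, hx2⟩ := (isSphereRadius_iff hn hx _).1 (hρ x hx)
  obtain ⟨hy1, hy2⟩ := (isSphereRadius_iff hn hy _).1 (hρ y hy)
  rw [← (strictMonoOn_sinPowIntegral n).lt_iff_lt (Ico_subset_Icc_self hx1)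
    (Ico_subset_Icc_self hy1), hx2, hy2]
  exact mul_lt_mul_of_pos_left (strictMonoOn_radialGaussianIntegral n hx hy hxy)
    (radialFactor_pos n)

/-- The intermediate value theorem is applied on the Gaussian side this time. For t < π the target
value lies strictly below the total mass, so some finite radius `M` exceeds it. -/
theorem exists_sphereRadius_eq {n : ℕ} (hn : 1 ≤ n) {ρ : ℝ → ℝ}
    (hρ : ∀ r : ℝ, 0 ≤ r → IsSphereRadius n r (ρ r)) {t : ℝ} (ht : t ∈ Ico 0 Real.pi) :
    ∃ r, 0 ≤ r ∧ ρ r = t := by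
  have hK := radialFactor_pos n
  have hlt : sinPowIntegral n t < radialFactor n *
      ∫ t in Ioi (0 : ℝ), t ^ (n - 1) * Real.exp (-t ^ 2 / 2) := by
    rw [← sinPowIntegral_pi hn]
    exact strictMonoOn_sinPowIntegral n (Ico_subset_Icc_self ht)
      (right_mem_Icc.2 Real.pi_pos.le) ht.2
  have h0 : 0 ≤ sinPowIntegral n t := by
    simpa using (strictMonoOn_sinPowIntegral n).monotoneOn (left_mem_Icc.2 Real.pi_pos.le)
      (Ico_subset_Icc_self ht) ht.1
  obtain ⟨M, hM, hM0⟩ := ((((tendsto_radialGaussianIntegral n).const_mul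
    (radialFactor n)).eventually_const_lt hlt).and (Filter.eventually_ge_atTop 0)).exists
  obtain ⟨r, hr, hr'⟩ := intermediate_value_Icc hM0
    ((continuous_radialGaussianIntegral n).const_mul (radialFactor n)).continuousOn
    (show sinPowIntegral n t ∈ Icc _ _ from ⟨by simpa using h0, hM.le⟩)
  refine ⟨r, hr.1, (existsUnique_isSphereRadius hn hr.1).unique (hρ r hr.1) ?_⟩
  exact (isSphereRadius_iff hn hr.1 t).2 ⟨ht, hr'.symm⟩

theorem sphereRadius_zero {n : ℕ} (hn : 1 ≤ n) {ρ : ℝ → ℝ}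
    (hρ : ∀ r : ℝ, 0 ≤ r → IsSphereRadius n r (ρ r)) : ρ 0 = 0 := by
  obtain ⟨r, hr, hr'⟩ := exists_sphereRadius_eq hn hρ ⟨le_rfl, Real.pi_pos⟩
  refine le_antisymm ?_ (hρ 0 le_rfl).1.1
  exact ((strictMonoOn_sphereRadius hn hρ).monotoneOn self_mem_Ici hr hr).trans hr'.le

theorem sphereRadius_pos {n : ℕ} (hn : 1 ≤ n) {ρ : ℝ → ℝ}
    (hρ : ∀ r : ℝ, 0 ≤ r → IsSphereRadius n r (ρ r)) {r : ℝ} (hr : 0 < r) : 0 < ρ r := by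
  rw [← sphereRadius_zero hn hρ]
  exact strictMonoOn_sphereRadius hn hρ self_mem_Ici hr.le hr

/-- Nothing is known about ρ on negative numbers. Truncating its argument at 0 gives a function
monotone on the whole line, hence Borel measurable. -/
theorem monotone_sphereRadius_max {n : ℕ} (hn : 1 ≤ n) {ρ : ℝ → ℝ}
    (hρ : ∀ r : ℝ, 0 ≤ r → IsSphereRadius n r (ρ r)) : Monotone fun r => ρ (max r 0) := fun _ _ h =>
  (strictMonoOn_sphereRadius hn hρ).monotoneOn (mem_Ici.2 (le_max_right _ _))
    (mem_Ici.2 (le_max_right _ _)) (max_le_max_right 0 h)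

/-! ### Transport of the radial densities -/

theorem setLIntegral_Ioc_ofReal {f : ℝ → ℝ} (hf : Continuous f) {x : ℝ} (hx : 0 ≤ x)
    (hpos : ∀ t ∈ Ioc 0 x, 0 ≤ f t) :
    ∫⁻ t in Ioc 0 x, ENNReal.ofReal (f t) = ENNReal.ofReal (∫ t in (0 : ℝ)..x, f t) := by
  rw [intervalIntegral.integral_of_le hx, ofReal_integral_eq_lintegral_ofReal hf.integrableOn_Ioc]
  exact ae_restrict_of_forall_mem measurableSet_Ioc hpos

/-- The solution of the radial equation transports the radial part of the normal distribution to
the radial part of the spherical volume. -/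
theorem map_sphereRadius {n : ℕ} (hn : 1 ≤ n) {ρ : ℝ → ℝ}
    (hρ : ∀ r : ℝ, 0 ≤ r → IsSphereRadius n r (ρ r)) :
    Measure.map (fun r => ρ (max r 0)) (ENNReal.ofReal (radialFactor n) •
      (volume.restrict (Ioi 0)).withDensity
        fun r : ℝ => ENNReal.ofReal (r ^ (n - 1) * Real.exp (-r ^ 2 / 2))) =
      (volume.restrict (Ioo 0 Real.pi)).withDensity
        fun s => ENNReal.ofReal (Real.sin s ^ (n - 1)) := by
  have hK := radialFactor_pos n
  have hm := (monotone_sphereRadius_max hn hρ).measurable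
  have hint := integrableOn_radialGaussian n
  have hpos : ∀ t ∈ Ioi (0 : ℝ), 0 ≤ t ^ (n - 1) * Real.exp (-t ^ 2 / 2) := fun t ht =>
    mul_nonneg (pow_nonneg (le_of_lt ht) _) (Real.exp_pos _).le
  have htot : ∫⁻ t in Ioi (0 : ℝ), ENNReal.ofReal (t ^ (n - 1) * Real.exp (-t ^ 2 / 2)) =
      ENNReal.ofReal (∫ t in Ioi (0 : ℝ), t ^ (n - 1) * Real.exp (-t ^ 2 / 2)) := by
    rw [ofReal_integral_eq_lintegral_ofReal hint]
    exact ae_restrict_of_forall_mem measurableSet_Ioi hpos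
  have hfin : IsFiniteMeasure (Measure.map (fun r => ρ (max r 0))
      (ENNReal.ofReal (radialFactor n) • (volume.restrict (Ioi 0)).withDensity
        fun r : ℝ => ENNReal.ofReal (r ^ (n - 1) * Real.exp (-r ^ 2 / 2)))) := by
    have : IsFiniteMeasure ((volume.restrict (Ioi 0)).withDensity
        fun r : ℝ => ENNReal.ofReal (r ^ (n - 1) * Real.exp (-r ^ 2 / 2))) :=
      isFiniteMeasure_withDensity (by rw [htot]; exact ENNReal.ofReal_ne_top)
    have := Measure.smul_finite ((volume.restrict (Ioi 0)).withDensity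
        fun r : ℝ => ENNReal.ofReal (r ^ (n - 1) * Real.exp (-r ^ 2 / 2)))
        (ENNReal.ofReal_ne_top (r := radialFactor n))
    infer_instance
  -- Finite measures on the line are determined by their distribution functions. These vanish for t
  -- < 0, agree by the radial equation for 0 ≤ t < π, and equal the common total mass for t ≥ π.
  refine Measure.ext_of_Iic _ _ fun t => ?_
  rw [Measure.map_apply hm measurableSet_Iic, Measure.smul_apply,
    withDensity_apply _ (hm measurableSet_Iic), withDensity_apply _ measurableSet_Iic,
    Measure.restrict_restrict (hm measurableSet_Iic), Measure.restrict_restrict measurableSet_Iic,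
    smul_eq_mul]
  rcases lt_or_ge t 0 with ht0 | ht0
  · have e1 : (fun r => ρ (max r 0)) ⁻¹' Iic t ∩ Ioi 0 = ∅ := by
      refine eq_empty_of_forall_notMem fun r hr => ?_
      have h1 : ρ (max r 0) ≤ t := hr.1
      exact absurd ((hρ (max r 0) (le_max_right _ _)).1.1.trans h1) (not_le.2 ht0)
    have e2 : Iic t ∩ Ioo 0 Real.pi = ∅ := by
      refine eq_empty_of_forall_notMem fun r hr => ?_
      exact absurd (hr.2.1.trans_le hr.1) (not_lt.2 ht0.le)
    simp [e1, e2]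
  have hsin : ∀ s ∈ Ioc (0 : ℝ) Real.pi, 0 ≤ Real.sin s ^ (n - 1) := fun s hs =>
    pow_nonneg (Real.sin_nonneg_of_mem_Icc (Ioc_subset_Icc_self hs)) _
  rcases lt_or_ge t Real.pi with htp | htp
  -- Writing t = ρ(r₀) turns the preimage into (0, r₀] by strict monotonicity, and the claim becomes
  -- the radial equation at r₀.
  · obtain ⟨r₀, hr₀, rfl⟩ := exists_sphereRadius_eq hn hρ ⟨ht0, htp⟩
    have e1 : (fun r => ρ (max r 0)) ⁻¹' Iic (ρ r₀) ∩ Ioi 0 = Ioc 0 r₀ := by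
      ext r
      refine ⟨fun h => ⟨h.2, ?_⟩, fun h => ⟨?_, h.1⟩⟩
      · have h1 : ρ (max r 0) ≤ ρ r₀ := h.1
        rw [max_eq_left (le_of_lt h.2)] at h1
        exact ((strictMonoOn_sphereRadius hn hρ).le_iff_le
          (mem_Ici.2 (le_of_lt h.2)) hr₀).1 h1
      · change ρ (max r 0) ≤ ρ r₀
        rw [max_eq_left h.1.le]
        exact (strictMonoOn_sphereRadius hn hρ).monotoneOn h.1.le hr₀ h.2
    have e2 : Iic (ρ r₀) ∩ Ioo 0 Real.pi = Ioc 0 (ρ r₀) := by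
      ext r
      exact ⟨fun h => ⟨h.2.1, h.1⟩, fun h => ⟨h.2, h.1, h.2.trans_lt htp⟩⟩
    rw [e1, e2, setLIntegral_Ioc_ofReal (by fun_prop) hr₀ (fun s hs => hpos s hs.1),
      setLIntegral_Ioc_ofReal (by fun_prop) ht0 (fun s hs => hsin s ⟨hs.1, hs.2.trans htp.le⟩),
      ← ENNReal.ofReal_mul hK.le]
    exact congrArg _ ((isSphereRadius_iff hn hr₀ _).1 (hρ r₀ hr₀)).2.symm
  · have e1 : (fun r => ρ (max r 0)) ⁻¹' Iic t ∩ Ioi 0 = Ioi 0 :=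
      inter_eq_right.2 fun r _ => ((hρ (max r 0) (le_max_right _ _)).1.2.le.trans htp)
    have e2 : Iic t ∩ Ioo 0 Real.pi = Ioo 0 Real.pi :=
      inter_eq_right.2 fun r hr => hr.2.le.trans htp
    rw [e1, e2, htot, restrict_Ioo_eq_restrict_Ioc,
      setLIntegral_Ioc_ofReal (by fun_prop) Real.pi_pos.le hsin, ← ENNReal.ofReal_mul hK.le]
    exact congrArg _ (sinPowIntegral_pi hn).symm

theorem lintegral_comp_sphereRadius {n : ℕ} (hn : 1 ≤ n) {ρ : ℝ → ℝ}
    (hρ : ∀ r : ℝ, 0 ≤ r → IsSphereRadius n r (ρ r)) {h : ℝ → ENNReal} (hh : Measurable h) :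
    ENNReal.ofReal (radialFactor n) *
        ∫⁻ r in Ioi (0 : ℝ), ENNReal.ofReal (r ^ (n - 1) * Real.exp (-r ^ 2 / 2)) * h (ρ r) =
      ∫⁻ s in Ioo 0 Real.pi, ENNReal.ofReal (Real.sin s ^ (n - 1)) * h s := by
  have hm := (monotone_sphereRadius_max hn hρ).measurable
  have e := congrArg (fun m => ∫⁻ x, h x ∂m) (map_sphereRadius hn hρ)
  rw [lintegral_map hh hm, lintegral_smul_measure,
    lintegral_withDensity_eq_lintegral_mul _ (by fun_prop) hh,
    lintegral_withDensity_eq_lintegral_mul (g := fun r => h (ρ (max r 0))) _ (by fun_prop)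
      (hh.comp hm)] at e
  simp only [Pi.mul_apply, smul_eq_mul] at e
  rw [← e]
  congr 1
  refine setLIntegral_congr_fun measurableSet_Ioi fun r hr => ?_
  rw [max_eq_left (le_of_lt hr)]

/-! ### Image measures under the radial map and the exponential map -/

theorem sphereVolume_pos (n : ℕ) : 0 < sphereVolume n := by
  have := Real.Gamma_pos_of_pos (show (0 : ℝ) < ((n : ℝ) + 1) / 2 by positivity)
  have := Real.pi_pos
  unfold sphereVolume
  positivity

theorem lintegral_normalMeasure {n : ℕ} (hn : 1 ≤ n) {f : EuclideanSpace ℝ (Fin n) → ENNReal}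
    (hf : Measurable f) :
    ∫⁻ x, f x ∂normalMeasure n 1 = ENNReal.ofReal (1 / (2 * Real.pi) ^ ((n : ℝ) / 2)) *
      ∫⁻ θ, ∫⁻ r in Ioi (0 : ℝ), ENNReal.ofReal (r ^ (n - 1) * Real.exp (-r ^ 2 / 2)) *
        f (r • θ.1) ∂volume ∂(volume : Measure (EuclideanSpace ℝ (Fin n))).toSphere := by
  have : Nonempty (Fin n) := ⟨⟨0, hn⟩⟩
  rw [normalMeasure, lintegral_withDensity_eq_lintegral_mul _ (by fun_prop) hf,
    lintegral_eq_lintegral_toSphere _ (Measurable.mul (by fun_prop) hf),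
    finrank_euclideanSpace_fin, ← lintegral_const_mul' _ _ ENNReal.ofReal_ne_top]
  refine lintegral_congr fun θ => ?_
  rw [← lintegral_const_mul' _ _ ENNReal.ofReal_ne_top]
  refine setLIntegral_congr_fun measurableSet_Ioi fun r hr => ?_
  have hθ : ‖θ.1‖ = 1 := mem_sphere_zero_iff_norm.1 θ.2
  have hr0 : (0 : ℝ) ≤ r := le_of_lt hr
  have := Real.pi_pos
  simp only [Pi.mul_apply, norm_smul, hθ, mul_one, Real.norm_of_nonneg hr0]
  rw [← mul_assoc, ← mul_assoc, ← ENNReal.ofReal_mul (by positivity),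
    ← ENNReal.ofReal_mul (by positivity)]
  congr 2
  ring

theorem lintegral_radialMeasure {n : ℕ} (hn : 1 ≤ n) {f : EuclideanSpace ℝ (Fin n) → ENNReal}
    (hf : Measurable f) :
    ∫⁻ x, f x ∂radialMeasure n Real.pi (fun s => sphereVolumeDensity n s / sphereVolume n) =
      ENNReal.ofReal (1 / sphereVolume n) *
      ∫⁻ θ, ∫⁻ s in Ioo (0 : ℝ) Real.pi, ENNReal.ofReal (Real.sin s ^ (n - 1)) *
        f (s • θ.1) ∂volume ∂(volume : Measure (EuclideanSpace ℝ (Fin n))).toSphere := by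
  have : Nonempty (Fin n) := ⟨⟨0, hn⟩⟩
  have hV := sphereVolume_pos n
  have hd : Measurable fun x : EuclideanSpace ℝ (Fin n) =>
      ENNReal.ofReal (sphereVolumeDensity n ‖x‖ / sphereVolume n) := by
    unfold sphereVolumeDensity
    fun_prop
  rw [radialMeasure, lintegral_withDensity_eq_lintegral_mul _ hd hf,
    ← lintegral_indicator measurableSet_ball,
    lintegral_eq_lintegral_toSphere _ ((Measurable.mul hd hf).indicator measurableSet_ball),
    finrank_euclideanSpace_fin, ← lintegral_const_mul' _ _ ENNReal.ofReal_ne_top]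
  refine lintegral_congr fun θ => ?_
  have hθ : ‖θ.1‖ = 1 := mem_sphere_zero_iff_norm.1 θ.2
  rw [← lintegral_const_mul' _ _ ENNReal.ofReal_ne_top, ← lintegral_indicator measurableSet_Ioi,
    ← lintegral_indicator measurableSet_Ioo]
  refine lintegral_congr fun s => ?_
  by_cases hs : 0 < s
  · have hns : ‖s • θ.1‖ = s := by rw [norm_smul, hθ, mul_one, Real.norm_of_nonneg hs.le]
    rw [indicator_of_mem (show s ∈ Ioi (0 : ℝ) from hs)]
    by_cases hsp : s < Real.pi
    · have hb : s • θ.1 ∈ Metric.ball (0 : EuclideanSpace ℝ (Fin n)) Real.pi := by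
        rwa [mem_ball_zero_iff, hns]
      have hsin := (Real.sin_pos_of_mem_Ioo ⟨hs, hsp⟩).le
      rw [indicator_of_mem hb, indicator_of_mem (show s ∈ Ioo (0 : ℝ) Real.pi from ⟨hs, hsp⟩)]
      simp only [Pi.mul_apply, hns, sphereVolumeDensity]
      rw [← mul_assoc, ← mul_assoc, ← ENNReal.ofReal_mul (by positivity),
        ← ENNReal.ofReal_mul (by positivity)]
      congr 2
      field_simp
    · have hb : s • θ.1 ∉ Metric.ball (0 : EuclideanSpace ℝ (Fin n)) Real.pi := by
        rwa [mem_ball_zero_iff, hns]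
      rw [indicator_of_notMem hb, mul_zero, indicator_of_notMem fun h => hsp h.2]
  · rw [indicator_of_notMem (show s ∉ Ioi (0 : ℝ) from hs), indicator_of_notMem fun h => hs h.1]

theorem radialMap_max (n : ℕ) (ρ : ℝ → ℝ) :
    radialMap n ρ = radialMap n fun r => ρ (max r 0) := by
  ext x
  simp [radialMap]

theorem measurable_radialMap {n : ℕ} (hn : 1 ≤ n) {ρ : ℝ → ℝ}
    (hρ : ∀ r : ℝ, 0 ≤ r → IsSphereRadius n r (ρ r)) : Measurable (radialMap n ρ) := by
  rw [radialMap_max]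
  have hm := (monotone_sphereRadius_max hn hρ).measurable.comp
    (measurable_norm (α := EuclideanSpace ℝ (Fin n)))
  exact (hm.div measurable_norm).smul measurable_id

/-- This reconciles the normalizing constants of the two measures once both are written in polar
coordinates. -/
theorem radialFactor_div_sphereVolume (n : ℕ) :
    radialFactor n * (1 / sphereVolume n) = 1 / (2 * Real.pi) ^ ((n : ℝ) / 2) := by
  have hG := Real.Gamma_pos_of_pos (show (0 : ℝ) < ((n : ℝ) + 1) / 2 by positivity)
  have hpi := Real.pi_pos
  have e1 : Real.pi ^ (((n : ℝ) + 1) / 2) = Real.pi ^ ((n : ℝ) / 2) * Real.sqrt Real.pi := by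
    rw [Real.sqrt_eq_rpow, ← Real.rpow_add hpi]
    congr 1; ring
  have e2 : (2 : ℝ) ^ (1 - (n : ℝ) / 2) * 2 ^ ((n : ℝ) / 2) = 2 := by
    rw [← Real.rpow_add (by norm_num)]
    simp
  have h1 : 0 < Real.pi ^ ((n : ℝ) / 2) := by positivity
  have h2 : 0 < (2 : ℝ) ^ ((n : ℝ) / 2) := by positivity
  have h3 : 0 < Real.sqrt Real.pi := Real.sqrt_pos.2 hpi
  rw [radialFactor, sphereVolume, e1, Real.mul_rpow (by norm_num) hpi.le]
  have e3 : (2 : ℝ) ^ (1 - (n : ℝ) / 2) = 2 / 2 ^ ((n : ℝ) / 2) := by rwa [eq_div_iff h2.ne']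
  rw [e3]
  field_simp

/-- On each ray ℝ₊θ the map acts as r ↦ ρ(r), so the one-dimensional transport applies for every
fixed θ. -/
theorem map_radialMap {n : ℕ} (hn : 1 ≤ n) {ρ : ℝ → ℝ}
    (hρ : ∀ r : ℝ, 0 ≤ r → IsSphereRadius n r (ρ r)) :
    Measure.map (radialMap n ρ) (normalMeasure n 1) =
      radialMeasure n Real.pi fun s => sphereVolumeDensity n s / sphereVolume n := by
  have hm := measurable_radialMap hn hρ
  refine Measure.ext fun B hB => ?_
  have hind : Measurable (B.indicator (1 : EuclideanSpace ℝ (Fin n) → ENNReal)) :=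
    measurable_one.indicator hB
  rw [← lintegral_indicator_one hB, ← lintegral_indicator_one hB, lintegral_map hind hm,
    lintegral_normalMeasure hn (f := fun x => B.indicator 1 (radialMap n ρ x)) (hind.comp hm),
    lintegral_radialMeasure hn hind,
    ← radialFactor_div_sphereVolume, mul_comm (radialFactor n),
    ENNReal.ofReal_mul (one_div_nonneg.2 (sphereVolume_pos n).le), mul_assoc]
  congr 1
  rw [← lintegral_const_mul' _ _ ENNReal.ofReal_ne_top]
  refine lintegral_congr fun θ => ?_
  have hθ : ‖θ.1‖ = 1 := mem_sphere_zero_iff_norm.1 θ.2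
  rw [← lintegral_comp_sphereRadius hn hρ (h := fun s => B.indicator 1 (s • θ.1))
    (hind.comp (by fun_prop))]
  congr 1
  refine setLIntegral_congr_fun measurableSet_Ioi fun r hr => ?_
  have hr' : r ≠ 0 := ne_of_gt hr
  have : radialMap n ρ (r • θ.1) = ρ r • θ.1 := by
    rw [radialMap, norm_smul, hθ, mul_one, Real.norm_of_nonneg (le_of_lt hr), smul_smul,
      div_mul_cancel₀ _ hr']
  simp only [this]

theorem toSphere_univ_euclidean (n : ℕ) :
    (volume : Measure (EuclideanSpace ℝ (Fin (n + 1)))).toSphere univ =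
      ENNReal.ofReal (sphereVolume n) := by
  have hpi := Real.pi_pos
  have hG := Real.Gamma_pos_of_pos (show (0 : ℝ) < ((n : ℝ) + 1) / 2 by positivity)
  have hn : (0 : ℝ) < (n : ℝ) + 1 := by positivity
  rw [Measure.toSphere_apply_univ, EuclideanSpace.volume_ball, finrank_euclideanSpace_fin,
    ENNReal.ofReal_one, one_pow, one_mul, Fintype.card_fin, ← ENNReal.ofReal_natCast,
    ← ENNReal.ofReal_mul (by positivity), sphereVolume, Nat.cast_add, Nat.cast_one,
    Real.Gamma_add_one (by positivity), Real.sqrt_eq_rpow, ← Real.rpow_mul_natCast hpi.le]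
  congr 1
  have : 1 / 2 * ((n + 1 : ℕ) : ℝ) = ((n : ℝ) + 1) / 2 := by push_cast; ring
  rw [this]
  field_simp

/-- The factor sⁿ⁻¹ of polar coordinates cancels the denominator of the density, leaving the area
element sinⁿ⁻¹ s of the sphere. -/
theorem map_sphereExp {n : ℕ} (hn : 1 ≤ n) :
    Measure.map (sphereExp n)
      (radialMeasure n Real.pi fun s => sphereVolumeDensity n s / sphereVolume n) =
        sphereUniform n := by
  have hm := measurable_sphereExp n
  refine Measure.ext fun A hA => ?_
  have hind : Measurable (A.indicator (1 : UnitSphere n → ENNReal)) :=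
    measurable_one.indicator hA
  rw [← lintegral_indicator_one hA, lintegral_map hind hm,
    lintegral_radialMeasure hn (f := fun x => A.indicator 1 (sphereExp n x)) (hind.comp hm),
    sphereUniform, Measure.smul_apply, smul_eq_mul,
    toSphere_apply_eq_lintegral_sphereExp hn hA, toSphere_univ_euclidean, one_div,
    ENNReal.ofReal_inv_of_pos (sphereVolume_pos n)]

/-! ### The error function, normal quantiles and the map from the cube -/

theorem hasDerivAt_errorFunction (t : ℝ) :
    HasDerivAt errorFunction (2 / Real.sqrt Real.pi * Real.exp (-t ^ 2)) t :=
  (intervalIntegral.integral_hasDerivAt_right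
    (Continuous.intervalIntegrable (by fun_prop) _ _)
    (Continuous.stronglyMeasurableAtFilter (by fun_prop) _ _)
    (Continuous.continuousAt (by fun_prop))).const_mul _

theorem continuous_errorFunction : Continuous errorFunction :=
  continuous_iff_continuousAt.2 fun t => (hasDerivAt_errorFunction t).continuousAt

theorem strictMono_errorFunction : StrictMono errorFunction := by
  refine strictMono_of_deriv_pos fun t => ?_
  rw [(hasDerivAt_errorFunction t).deriv]
  have := Real.sqrt_pos.2 Real.pi_pos
  positivity

theorem errorFunction_neg (t : ℝ) : errorFunction (-t) = -errorFunction t := by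
  have h := intervalIntegral.integral_comp_neg (a := 0) (b := t) fun s : ℝ => Real.exp (-s ^ 2)
  simp only [even_two, Even.neg_pow, neg_zero] at h
  rw [errorFunction, errorFunction, h, intervalIntegral.integral_symm 0 (-t)]
  simp

theorem tendsto_errorFunction_atTop :
    Filter.Tendsto errorFunction Filter.atTop (nhds 1) := by
  have hi : IntegrableOn (fun s : ℝ => Real.exp (-s ^ 2)) (Ioi 0) := by
    simpa using (integrable_exp_neg_mul_sq (b := 1) one_pos).integrableOn (s := Ioi 0)
  have hv : ∫ s in Ioi (0 : ℝ), Real.exp (-s ^ 2) = Real.sqrt Real.pi / 2 := by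
    simpa using integral_gaussian_Ioi 1
  have h := (intervalIntegral_tendsto_integral_Ioi 0 hi Filter.tendsto_id).const_mul
    (2 / Real.sqrt Real.pi)
  have h0 : Real.sqrt Real.pi ≠ 0 := (Real.sqrt_pos.2 Real.pi_pos).ne'
  rw [hv, show 2 / Real.sqrt Real.pi * (Real.sqrt Real.pi / 2) = 1 by field_simp] at h
  exact h

theorem tendsto_errorFunction_atBot :
    Filter.Tendsto errorFunction Filter.atBot (nhds (-1)) := by
  refine (tendsto_errorFunction_atTop.comp Filter.tendsto_neg_atBot_atTop).neg.congr fun t => ?_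
  simp [errorFunction_neg]

theorem errorFunction_mem_Ioo (t : ℝ) : errorFunction t ∈ Ioo (-1 : ℝ) 1 := by
  have h : ∀ t, errorFunction t < 1 := fun t =>
    (strictMono_errorFunction (lt_add_one t)).trans_le
      (strictMono_errorFunction.monotone.ge_of_tendsto tendsto_errorFunction_atTop _)
  refine ⟨?_, h t⟩
  have := h (-t)
  rw [errorFunction_neg] at this
  linarith

theorem errorFunctionInv_errorFunction (t : ℝ) : errorFunctionInv (errorFunction t) = t :=
  Function.leftInverse_invFun strictMono_errorFunction.injective t

theorem errorFunction_errorFunctionInv {y : ℝ} (hy : y ∈ Ioo (-1 : ℝ) 1) :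
    errorFunction (errorFunctionInv y) = y := by
  refine Function.invFun_eq ?_
  obtain ⟨a, ha⟩ := (tendsto_errorFunction_atBot.eventually_lt_const hy.1).exists
  obtain ⟨b, hb⟩ := (tendsto_errorFunction_atTop.eventually_const_lt hy.2).exists
  exact mem_range_of_exists_le_of_exists_ge continuous_errorFunction ⟨a, ha.le⟩ ⟨b, hb.le⟩

/-- The distribution function of the standard normal distribution. -/
def normalCDF (a : ℝ) : ℝ := (1 + errorFunction (a / Real.sqrt 2)) / 2

/-- The quantile function of the standard normal distribution. -/
def normalQuantile (x : ℝ) : ℝ := Real.sqrt 2 * errorFunctionInv (2 * x - 1)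

theorem normalCDF_mem_Ioo (a : ℝ) : normalCDF a ∈ Ioo (0 : ℝ) 1 := by
  have := errorFunction_mem_Ioo (a / Real.sqrt 2)
  constructor <;> unfold normalCDF <;> linarith [this.1, this.2]

theorem strictMono_normalCDF : StrictMono normalCDF := by
  intro a b hab
  have h2 : 0 < Real.sqrt 2 := by positivity
  have := strictMono_errorFunction ((div_lt_div_iff_of_pos_right h2).2 hab)
  unfold normalCDF
  linarith

theorem normalQuantile_normalCDF (a : ℝ) : normalQuantile (normalCDF a) = a := by
  have h2 : Real.sqrt 2 ≠ 0 := by positivity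
  rw [normalQuantile, normalCDF, show 2 * ((1 + errorFunction (a / Real.sqrt 2)) / 2) - 1 =
    errorFunction (a / Real.sqrt 2) by ring, errorFunctionInv_errorFunction]
  field_simp

theorem errorFunction_normalQuantile {x : ℝ} (hx : x ∈ Ioo (0 : ℝ) 1) :
    errorFunction (normalQuantile x / Real.sqrt 2) = 2 * x - 1 := by
  have h2 : Real.sqrt 2 ≠ 0 := by positivity
  rw [normalQuantile, mul_div_cancel_left₀ _ h2, errorFunction_errorFunctionInv]
  constructor <;> linarith [hx.1, hx.2]

theorem normalCDF_normalQuantile {x : ℝ} (hx : x ∈ Ioo (0 : ℝ) 1) :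
    normalCDF (normalQuantile x) = x := by
  rw [normalCDF, errorFunction_normalQuantile hx]
  ring

/-- This equivalence makes the preimage of a half line an interval with endpoint `normalCDF a`,
which gives both monotonicity and the image measure. -/
theorem normalQuantile_le_iff {x : ℝ} (hx : x ∈ Ioo (0 : ℝ) 1) (a : ℝ) :
    normalQuantile x ≤ a ↔ x ≤ normalCDF a := by
  rw [← strictMono_normalCDF.le_iff_le, normalCDF_normalQuantile hx]

theorem measurable_normalQuantile : Measurable fun x : Ioo (0 : ℝ) 1 => normalQuantile x := by
  have : Monotone fun x : Ioo (0 : ℝ) 1 => normalQuantile x := fun x y h => by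
    simp only
    rw [normalQuantile_le_iff x.2, normalCDF_normalQuantile y.2]
    exact h
  exact this.measurable

theorem hasDerivAt_normalCDF (a : ℝ) :
    HasDerivAt normalCDF (ProbabilityTheory.gaussianPDFReal 0 1 a) a := by
  have h2 : (0 : ℝ) < Real.sqrt 2 := by positivity
  have h := (((hasDerivAt_errorFunction (a / Real.sqrt 2)).comp a
    ((hasDerivAt_id a).div_const (Real.sqrt 2))).const_add 1).div_const 2
  refine h.congr_deriv ?_
  have hpi := Real.sqrt_pos.2 Real.pi_pos
  have e : -(a / Real.sqrt 2) ^ 2 = -(a - 0) ^ 2 / (2 * ((1 : NNReal) : ℝ)) := by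
    rw [div_pow, Real.sq_sqrt (by norm_num)]
    simp [neg_div]
  have e' : Real.sqrt (2 * Real.pi * ((1 : NNReal) : ℝ)) = Real.sqrt 2 * Real.sqrt Real.pi := by
    rw [NNReal.coe_one, mul_one, Real.sqrt_mul (by norm_num)]
  rw [ProbabilityTheory.gaussianPDFReal, e, e']
  field_simp

theorem gaussianReal_Iic (a : ℝ) :
    ProbabilityTheory.gaussianReal 0 1 (Iic a) = ENNReal.ofReal (normalCDF a) := by
  have hb : Filter.Tendsto normalCDF Filter.atBot (nhds 0) := by
    have h2 : (0 : ℝ) < Real.sqrt 2 := by positivity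
    have h := ((tendsto_errorFunction_atBot.comp
      (Filter.tendsto_id.atBot_div_const h2)).const_add 1).div_const 2
    simpa using h.congr fun a => (rfl : _ = normalCDF a)
  rw [ProbabilityTheory.gaussianReal_apply_eq_integral _ one_ne_zero,
    integral_Iic_of_hasDerivAt_of_tendsto (hasDerivAt_normalCDF a).continuousAt.continuousWithinAt
      (fun x _ => hasDerivAt_normalCDF x)
      (ProbabilityTheory.integrable_gaussianPDFReal 0 1).integrableOn hb, sub_zero]

/-- Inverse transform sampling: the preimage of (-∞, a] is (0, `normalCDF a`], whose length is the
Gaussian mass of (-∞, a]. Stating it for image sets in ℝ suits the description of boxes in the cube.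
-/
theorem volume_image_normalQuantile_preimage {s : Set ℝ} (hs : MeasurableSet s) :
    volume (Subtype.val '' ((fun x : Ioo (0 : ℝ) 1 => normalQuantile x) ⁻¹' s)) =
      ProbabilityTheory.gaussianReal 0 1 s := by
  have hm := measurable_normalQuantile
  have key : ProbabilityTheory.gaussianReal 0 1 =
      Measure.map (fun x : Ioo (0 : ℝ) 1 => normalQuantile x)
        (Measure.comap Subtype.val (volume : Measure ℝ)) := by
    refine Measure.ext_of_Iic _ _ fun a => ?_
    have e : Subtype.val '' ((fun x : Ioo (0 : ℝ) 1 => normalQuantile x) ⁻¹' Iic a) =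
        Ioc 0 (normalCDF a) := by
      ext x
      constructor
      · rintro ⟨y, hy, rfl⟩
        exact ⟨y.2.1, (normalQuantile_le_iff y.2 a).1 hy⟩
      · intro hx
        have hx' : x ∈ Ioo (0 : ℝ) 1 := ⟨hx.1, hx.2.trans_lt (normalCDF_mem_Ioo a).2⟩
        exact ⟨⟨x, hx'⟩, (normalQuantile_le_iff hx' a).2 hx.2, rfl⟩
    rw [gaussianReal_Iic, Measure.map_apply hm measurableSet_Iic,
      comap_subtype_coe_apply measurableSet_Ioo, e, Real.volume_Ioc, sub_zero]
  rw [key, Measure.map_apply hm hs, comap_subtype_coe_apply measurableSet_Ioo]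

theorem cubeToEuclidean_apply (n : ℕ) (x : openCube n) (i : Fin n) :
    cubeToEuclidean n x i = normalQuantile (x.1 i) := rfl

theorem measurableSet_openCube (n : ℕ) : MeasurableSet (openCube n) := by
  have : openCube n = ⋂ i, (fun x : EuclideanSpace ℝ (Fin n) => x i) ⁻¹' Ioo 0 1 := by
    ext x
    simp [openCube]
  rw [this]
  exact MeasurableSet.iInter fun i => measurableSet_Ioo.preimage (by fun_prop)

theorem measurable_cubeToEuclidean (n : ℕ) : Measurable (cubeToEuclidean n) := by
  refine (WithLp.measurable_toLp 2 _).comp (measurable_pi_lambda _ fun i => ?_)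
  exact measurable_normalQuantile.comp (g := fun x : Ioo (0 : ℝ) 1 => normalQuantile x)
    (f := fun x : openCube n => ⟨x.1 i, x.2 i⟩) (Measurable.subtype_mk (by fun_prop))

/-- Since e^(-‖x‖²/2) factors over the coordinates, the masses of boxes are products, and boxes
determine a product measure. -/
theorem map_ofLp_normalMeasure (n : ℕ) :
    Measure.pi (fun _ : Fin n => ProbabilityTheory.gaussianReal 0 1) =
      Measure.map WithLp.ofLp (normalMeasure n 1) := by
  refine Measure.pi_eq fun s hs => ?_
  have hbox : MeasurableSet (univ.pi s) := MeasurableSet.univ_pi hs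
  have hofLp : Measurable (@WithLp.ofLp 2 (Fin n → ℝ)) := WithLp.measurable_ofLp 2 _
  have hpdf : ∀ y : EuclideanSpace ℝ (Fin n),
      1 / (2 * Real.pi * 1) ^ ((n : ℝ) / 2) * Real.exp (-‖y‖ ^ 2 / (2 * 1)) =
        ∏ i, ProbabilityTheory.gaussianPDFReal 0 1 (y i) := by
    intro y
    have hpi : (0 : ℝ) < 2 * Real.pi * 1 := by have := Real.pi_pos; positivity
    simp only [ProbabilityTheory.gaussianPDFReal, Finset.prod_mul_distrib, Finset.prod_const,
      Finset.card_univ, Fintype.card_fin, ← Real.exp_sum, NNReal.coe_one]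
    congr 1
    · rw [inv_pow, one_div, Real.sqrt_eq_rpow, ← Real.rpow_mul_natCast hpi.le]
      congr 2; ring
    · rw [EuclideanSpace.norm_sq_eq, ← Finset.sum_div, Finset.sum_neg_distrib]
      simp
  have hint : Integrable (fun y : Fin n → ℝ => ∏ i, ProbabilityTheory.gaussianPDFReal 0 1 (y i))
      (Measure.pi fun i => (volume : Measure ℝ).restrict (s i)) :=
    Integrable.fintype_prod fun i =>
      (ProbabilityTheory.integrable_gaussianPDFReal 0 1).restrict
  rw [Measure.map_apply hofLp hbox, normalMeasure, withDensity_apply _ (hofLp hbox)]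
  simp_rw [hpdf]
  rw [(PiLp.volume_preserving_ofLp (Fin n)).setLIntegral_comp_preimage hbox
    (f := fun y : Fin n → ℝ => ENNReal.ofReal
      (∏ i, ProbabilityTheory.gaussianPDFReal 0 1 (y i))) (by fun_prop), volume_pi,
    Measure.restrict_pi_pi, ← ofReal_integral_eq_lintegral_ofReal hint,
    integral_fintype_prod_eq_prod,
    ENNReal.ofReal_prod_of_nonneg fun i _ => integral_nonneg
      fun x => ProbabilityTheory.gaussianPDFReal_nonneg 0 1 x]
  · refine Finset.prod_congr rfl fun i _ => ?_
    rw [ProbabilityTheory.gaussianReal_apply_eq_integral _ one_ne_zero]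
  · exact Filter.Eventually.of_forall fun y => Finset.prod_nonneg
      fun i _ => ProbabilityTheory.gaussianPDFReal_nonneg 0 1 _

/-- The map acts coordinatewise, so the preimage of a box is a box and its volume is a product of
one-dimensional Gaussian masses. -/
theorem map_cubeToEuclidean (n : ℕ) :
    Measure.map (cubeToEuclidean n) (cubeUniform n) = normalMeasure n 1 := by
  have hm := measurable_cubeToEuclidean n
  have hofLp : Measurable (@WithLp.ofLp 2 (Fin n → ℝ)) := WithLp.measurable_ofLp 2 _
  have htoLp : Measurable (@WithLp.toLp 2 (Fin n → ℝ)) := WithLp.measurable_toLp 2 _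
  have key : Measure.pi (fun _ : Fin n => ProbabilityTheory.gaussianReal 0 1) =
      Measure.map WithLp.ofLp (Measure.map (cubeToEuclidean n) (cubeUniform n)) := by
    refine Measure.pi_eq fun s hs => ?_
    have hbox : MeasurableSet (univ.pi s) := MeasurableSet.univ_pi hs
    have e : Subtype.val '' (cubeToEuclidean n ⁻¹' (WithLp.ofLp ⁻¹' univ.pi s)) =
        WithLp.ofLp ⁻¹' univ.pi fun i =>
          Subtype.val '' ((fun x : Ioo (0 : ℝ) 1 => normalQuantile x) ⁻¹' s i) := by
      ext x
      constructor
      · rintro ⟨y, hy, rfl⟩ i -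
        exact ⟨⟨y.1 i, y.2 i⟩, hy i trivial, rfl⟩
      · intro hx
        have hx' : ∀ i, ∃ h : x i ∈ Ioo (0 : ℝ) 1, normalQuantile (x i) ∈ s i := by
          intro i
          obtain ⟨y, hy, hyx⟩ := hx i trivial
          have hyx : y.1 = x i := hyx
          rw [← hyx]
          exact ⟨y.2, hy⟩
        exact ⟨⟨x, fun i => (hx' i).1⟩, fun i _ => (hx' i).2, rfl⟩
    rw [Measure.map_apply hofLp hbox, Measure.map_apply hm (hofLp hbox), cubeUniform,
      comap_subtype_coe_apply (measurableSet_openCube n), e,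
      (PiLp.volume_preserving_ofLp (Fin n)).measure_preimage, volume_pi, Measure.pi_pi]
    · exact Finset.prod_congr rfl fun i _ => volume_image_normalQuantile_preimage (hs i)
    · exact (MeasurableSet.univ_pi fun i => measurableSet_Ioo.subtype_image
        (measurable_normalQuantile (hs i))).nullMeasurableSet
  rw [map_ofLp_normalMeasure] at key
  have := congrArg (Measure.map (WithLp.toLp 2)) key
  rw [Measure.map_map htoLp hofLp, Measure.map_map htoLp hofLp] at this
  have hid : (WithLp.toLp 2 ∘ WithLp.ofLp : EuclideanSpace ℝ (Fin n) → _) = id := rfl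
  rw [hid, Measure.map_id, Measure.map_id] at this
  exact this.symm

theorem injective_cubeToEuclidean (n : ℕ) : Function.Injective (cubeToEuclidean n) := by
  intro x y h
  refine Subtype.ext (PiLp.ext fun i => ?_)
  have hi := congrArg (fun v : EuclideanSpace ℝ (Fin n) => normalCDF (v i)) h
  simpa only [cubeToEuclidean_apply, normalCDF_normalQuantile (x.2 i),
    normalCDF_normalQuantile (y.2 i)] using hi

theorem surjective_cubeToEuclidean (n : ℕ) : Function.Surjective (cubeToEuclidean n) := by
  intro v
  refine ⟨⟨WithLp.toLp 2 fun i => normalCDF (v i), fun i => normalCDF_mem_Ioo _⟩, ?_⟩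
  ext i
  exact normalQuantile_normalCDF (v i)

/-! ### Bijectivity and the measure-preserving maps -/

/-- By the Lusin–Souslin theorem an injective measurable map on a standard Borel space sends
measurable sets to measurable sets. So the inverse is measurable, and the complement of the range is
a measurable set with empty preimage. -/
theorem isMeasurePreservingOnto_of_map {α β : Type*} [MeasurableSpace α] [StandardBorelSpace α]
    [MeasurableSpace β] [MeasurableSpace.CountablySeparated β] {f : α → β} {μ : Measure α}
    {ν : Measure β} {T : Set β} (hinj : Function.Injective f) (hf : Measurable f)
    (hrange : range f = T) (hmap : Measure.map f μ = ν) : IsMeasurePreservingOnto f μ ν T where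
  injective := hinj
  range_eq := hrange
  null_compl := by
    have hT : MeasurableSet T := by
      rw [← hrange, ← image_univ]
      exact MeasurableSet.univ.image_of_measurable_injOn hf hinj.injOn
    rw [← hmap, Measure.map_apply hf hT.compl, ← hrange, preimage_compl, preimage_range,
      compl_univ, measure_empty]
  measurable := hf
  measurableSet_image A hA := hA.image_of_measurable_injOn hf hinj.injOn
  measure_preimage B hB := by rw [← hmap, Measure.map_apply hf hB]

theorem norm_radialMap {n : ℕ} (hn : 1 ≤ n) {ρ : ℝ → ℝ}
    (hρ : ∀ r : ℝ, 0 ≤ r → IsSphereRadius n r (ρ r)) (x : EuclideanSpace ℝ (Fin n)) :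
    ‖radialMap n ρ x‖ = ρ ‖x‖ := by
  have h0 := (hρ ‖x‖ (norm_nonneg x)).1.1
  by_cases hx : x = 0
  · simp [hx, radialMap, sphereRadius_zero hn hρ]
  · rw [radialMap, norm_smul, Real.norm_of_nonneg (by positivity),
      div_mul_cancel₀ _ (norm_ne_zero_iff.2 hx)]

theorem injective_radialMap {n : ℕ} (hn : 1 ≤ n) {ρ : ℝ → ℝ}
    (hρ : ∀ r : ℝ, 0 ≤ r → IsSphereRadius n r (ρ r)) : Function.Injective (radialMap n ρ) := by
  intro x y h
  have hnorm : ‖x‖ = ‖y‖ := by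
    refine (strictMonoOn_sphereRadius hn hρ).injOn (norm_nonneg x) (norm_nonneg y) ?_
    rw [← norm_radialMap hn hρ, ← norm_radialMap hn hρ, h]
  by_cases hx : x = 0
  · rw [hx, norm_zero, eq_comm, norm_eq_zero] at hnorm
    rw [hx, hnorm]
  · have hx0 : 0 < ‖x‖ := norm_pos_iff.2 hx
    rw [radialMap, radialMap, ← hnorm] at h
    exact smul_right_injective _ (div_pos (sphereRadius_pos hn hρ hx0) hx0).ne' h

theorem range_radialMap {n : ℕ} (hn : 1 ≤ n) {ρ : ℝ → ℝ}
    (hρ : ∀ r : ℝ, 0 ≤ r → IsSphereRadius n r (ρ r)) :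
    range (radialMap n ρ) = Metric.ball 0 Real.pi := by
  ext v
  rw [mem_ball_zero_iff]
  constructor
  · rintro ⟨x, rfl⟩
    rw [norm_radialMap hn hρ]
    exact (hρ ‖x‖ (norm_nonneg x)).1.2
  · intro hv
    obtain ⟨r, hr, hrv⟩ := exists_sphereRadius_eq hn hρ ⟨norm_nonneg v, hv⟩
    by_cases hv0 : v = 0
    · exact ⟨0, by simp [radialMap, hv0]⟩
    · have hv1 : ‖v‖ ≠ 0 := norm_ne_zero_iff.2 hv0
      have hr0 : r ≠ 0 := by
        rintro rfl
        exact hv1 (hrv.symm.trans (sphereRadius_zero hn hρ))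
      refine ⟨(r / ‖v‖) • v, ?_⟩
      have : ‖(r / ‖v‖) • v‖ = r := by
        rw [norm_smul, Real.norm_of_nonneg (by positivity), div_mul_cancel₀ _ hv1]
      rw [radialMap, this, hrv, smul_smul, div_mul_div_cancel₀ hr0, div_self hv1, one_smul]

theorem sphereExp_castSucc (n : ℕ) (v : EuclideanSpace ℝ (Fin n)) (i : Fin n) :
    (sphereExp n v).1 i.castSucc = v i / ‖v‖ * Real.sin ‖v‖ := by
  simp [sphereExp, sphereExpVec]

theorem sphereExp_last (n : ℕ) (v : EuclideanSpace ℝ (Fin n)) :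
    (sphereExp n v).1 (Fin.last n) = Real.cos ‖v‖ := by
  simp [sphereExp, sphereExpVec]

/-- The last coordinate recovers ‖v‖ since cosine is injective on [0, π]; then sin ‖v‖ ≠ 0 recovers
the direction. -/
theorem injOn_sphereExp (n : ℕ) : InjOn (sphereExp n) (Metric.ball 0 Real.pi) := by
  intro v hv w hw h
  rw [mem_ball_zero_iff] at hv hw
  have hnorm : ‖v‖ = ‖w‖ := by
    refine Real.injOn_cos ⟨norm_nonneg v, hv.le⟩ ⟨norm_nonneg w, hw.le⟩ ?_
    rw [← sphereExp_last, ← sphereExp_last, h]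
  by_cases hv0 : v = 0
  · rw [hv0, norm_zero, eq_comm, norm_eq_zero] at hnorm
    rw [hv0, hnorm]
  · have hv1 : 0 < ‖v‖ := norm_pos_iff.2 hv0
    have hs := Real.sin_pos_of_pos_of_lt_pi hv1 hv
    ext i
    have hi := congrArg (fun p : UnitSphere n => p.1 i.castSucc) h
    simp only [sphereExp_castSucc, ← hnorm] at hi
    exact (div_left_inj' hv1.ne').1 (mul_right_cancel₀ hs.ne' hi)

theorem image_sphereExp_ball (n : ℕ) :
    sphereExp n '' Metric.ball 0 Real.pi = {southPole n}ᶜ := by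
  ext p
  rw [mem_compl_singleton_iff]
  constructor
  · rintro ⟨v, hv, rfl⟩ h
    rw [mem_ball_zero_iff] at hv
    have hl := congrArg (fun p : UnitSphere n => p.1 (Fin.last n)) h
    simp only [sphereExp_last, southPole, PiLp.single_apply, if_true] at hl
    have := Real.strictAntiOn_cos ⟨norm_nonneg v, hv.le⟩ ⟨Real.pi_pos.le, le_rfl⟩ hv
    rw [hl, Real.cos_pi] at this
    exact lt_irrefl _ this
  · intro hp
    have hnorm : ∑ i : Fin n, p.1 i.castSucc ^ 2 + p.1 (Fin.last n) ^ 2 = 1 := by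
      have h := EuclideanSpace.norm_sq_eq p.1
      rw [mem_sphere_zero_iff_norm.1 p.2, Fin.sum_univ_castSucc] at h
      simpa using h.symm
    set z := p.1 (Fin.last n) with hz
    have hsum : 0 ≤ ∑ i : Fin n, p.1 i.castSucc ^ 2 := Finset.sum_nonneg fun _ _ => sq_nonneg _
    have hcoord : z ^ 2 = 1 → ∀ i : Fin n, p.1 i.castSucc = 0 := by
      intro h i
      have h0 : ∑ i : Fin n, p.1 i.castSucc ^ 2 = 0 := by linarith
      have := (Finset.sum_eq_zero_iff_of_nonneg fun _ _ => sq_nonneg _).1 h0 i (Finset.mem_univ i)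
      simpa using this
    have hz1 : z ≤ 1 := by nlinarith
    have hz2 : -1 ≤ z := by nlinarith
    have hz3 : z ≠ -1 := by
      intro h
      refine hp (Subtype.ext (PiLp.ext fun i => ?_))
      refine Fin.lastCases ?_ (fun j => ?_) i
      · rw [← hz, h]
        simp [southPole]
      · rw [hcoord (by rw [h]; norm_num) j]
        simp [southPole, (Fin.castSucc_lt_last j).ne]
    set s := Real.arccos z with hs
    have hs0 : 0 ≤ s := Real.arccos_nonneg z
    have hsp : s < Real.pi := by
      refine lt_of_le_of_ne (Real.arccos_le_pi z) fun h => hz3 ?_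
      exact le_antisymm (Real.arccos_eq_pi.1 h) hz2
    have hcos : Real.cos s = z := Real.cos_arccos hz2 hz1
    have hsin : Real.sin s ^ 2 = ∑ i : Fin n, p.1 i.castSucc ^ 2 := by
      have := Real.sin_sq_add_cos_sq s
      rw [hcos] at this
      linarith
    -- The horizontal part of `p` has length sin s and is rescaled to length s. At the north pole
    -- the factor is 0/0 = 0, which correctly gives the zero vector.
    have hv : ‖(WithLp.toLp 2 fun i : Fin n => s / Real.sin s * p.1 i.castSucc :
        EuclideanSpace ℝ (Fin n))‖ = s := by
      refine (sq_eq_sq₀ (norm_nonneg _) hs0).1 ?_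
      rw [EuclideanSpace.norm_sq_eq]
      simp only [Real.norm_eq_abs, sq_abs, mul_pow, ← Finset.mul_sum]
      rw [← hsin]
      rcases hs0.eq_or_lt with h | h
      · simp [← h]
      · have := Real.sin_pos_of_pos_of_lt_pi h hsp
        field_simp
    refine ⟨_, by rw [mem_ball_zero_iff, hv]; exact hsp, Subtype.ext (PiLp.ext fun i => ?_)⟩
    refine Fin.lastCases ?_ (fun j => ?_) i
    · rw [sphereExp_last, hv, hcos]
    · rw [sphereExp_castSucc, hv]
      simp only
      rcases hs0.eq_or_lt with h | h
      · rw [hcoord (by rw [← hcos, ← h]; simp) j]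
        simp
      · have := Real.sin_pos_of_pos_of_lt_pi h hsp
        field_simp

theorem isMeasurePreservingOnto_radialMap {n : ℕ} (hn : 1 ≤ n) {ρ : ℝ → ℝ}
    (hρ : ∀ r : ℝ, 0 ≤ r → IsSphereRadius n r (ρ r)) :
    IsMeasurePreservingOnto (radialMap n ρ) (normalMeasure n 1)
      (radialMeasure n Real.pi fun s => sphereVolumeDensity n s / sphereVolume n)
      (Metric.ball 0 Real.pi) :=
  isMeasurePreservingOnto_of_map (injective_radialMap hn hρ) (measurable_radialMap hn hρ)
    (range_radialMap hn hρ) (map_radialMap hn hρ)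

theorem isMeasurePreservingOnto_cubeToSphere {n : ℕ} (hn : 1 ≤ n) {ρ : ℝ → ℝ}
    (hρ : ∀ r : ℝ, 0 ≤ r → IsSphereRadius n r (ρ r)) :
    IsMeasurePreservingOnto (cubeToSphere n ρ) (cubeUniform n) (sphereUniform n)
      {southPole n}ᶜ := by
  have : StandardBorelSpace (openCube n) := (measurableSet_openCube n).standardBorel
  have h1 := measurable_cubeToEuclidean n
  have h2 := measurable_radialMap hn hρ
  have h3 := measurable_sphereExp n
  refine isMeasurePreservingOnto_of_map (fun x y h => ?_) (h3.comp (h2.comp h1)) ?_ ?_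
  · refine injective_cubeToEuclidean n (injective_radialMap hn hρ (injOn_sphereExp n ?_ ?_ h)) <;>
    · rw [← range_radialMap hn hρ]
      exact mem_range_self _
  · rw [cubeToSphere, range_comp, range_comp, (surjective_cubeToEuclidean n).range_eq, image_univ,
      range_radialMap hn hρ, image_sphereExp_ball]
  · rw [cubeToSphere, ← Measure.map_map h3 (h2.comp h1), ← Measure.map_map h2 h1,
      map_cubeToEuclidean, map_radialMap hn hρ, map_sphereExp hn]

/-! ### Explicit formulas on the circle and the two-dimensional sphere -/

theorem sqrt_pi_mul_lowerIncompleteGamma_half {r : ℝ} (hr : 0 ≤ r) :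
    Real.sqrt Real.pi * lowerIncompleteGamma (1 / 2) (r ^ 2 / 2) =
      Real.pi * errorFunction (r / Real.sqrt 2) := by
  have h2 : Real.sqrt 2 ≠ 0 := by positivity
  have hpi := (Real.sqrt_pos.2 Real.pi_pos).ne'
  have h := lowerIncompleteGamma_half_sq le_rfl hr
  have e := intervalIntegral.integral_comp_div (a := 0) (b := r)
    (fun t : ℝ => Real.exp (-t ^ 2)) h2
  simp only [div_pow, Real.sq_sqrt zero_le_two, zero_div, smul_eq_mul] at e
  have e' : ∀ t : ℝ, -(t ^ 2 / 2) = -t ^ 2 / 2 := fun t => by ring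
  simp only [e'] at e
  rw [Nat.cast_one, show (1 : ℝ) - 1 / 2 = 1 / 2 by norm_num, ← Real.sqrt_eq_rpow,
    radialGaussianIntegral] at h
  simp only [Nat.sub_self, pow_zero, one_mul] at h
  rw [h, e, errorFunction, ← mul_assoc (Real.sqrt 2), Real.mul_self_sqrt zero_le_two]
  nth_rewrite 2 [← Real.mul_self_sqrt Real.pi_pos.le]
  field_simp

/-- For n = 1 the integrand sin⁰ is 1 and Γ(1) = 1, so the radial equation is already solved for s.
-/
theorem sphereRadius_one {r s : ℝ} (hr : 0 ≤ r) (h : IsSphereRadius 1 r s) :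
    s = Real.pi * errorFunction (r / Real.sqrt 2) := by
  have h' := h.2
  rw [← sqrt_pi_mul_lowerIncompleteGamma_half hr]
  simpa [Real.Gamma_one] using h'

theorem sphereExp_one (v : EuclideanSpace ℝ (Fin 1)) :
    (sphereExp 1 v).1 = !₂[Real.sin (v 0), Real.cos (v 0)] := by
  have hv : ‖v‖ = |v 0| := by
    simp [EuclideanSpace.norm_eq, Real.sqrt_sq_eq_abs]
  ext i
  refine Fin.lastCases ?_ (fun j => ?_) i
  · rw [sphereExp_last, hv, Real.cos_abs]
    rfl
  · rw [sphereExp_castSucc, hv, Subsingleton.elim j 0]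
    change _ = Real.sin (v 0)
    rcases lt_trichotomy (v 0) 0 with h | h | h
    · rw [abs_of_neg h, Real.sin_neg]
      have := h.ne
      field_simp
    · simp [h]
    · rw [abs_of_pos h, div_self h.ne', one_mul]

/-- Oddness of the error function absorbs the sign of y/|y|, so a single formula covers both half
lines. -/
theorem radialMap_one_apply {ρ : ℝ → ℝ} (hρ : ∀ r : ℝ, 0 ≤ r → IsSphereRadius 1 r (ρ r))
    (y : EuclideanSpace ℝ (Fin 1)) :
    radialMap 1 ρ y 0 = Real.pi * errorFunction (y 0 / Real.sqrt 2) := by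
  have hy : ‖y‖ = |y 0| := by
    simp [EuclideanSpace.norm_eq, Real.sqrt_sq_eq_abs]
  rw [radialMap, hy, PiLp.smul_apply, smul_eq_mul,
    sphereRadius_one (abs_nonneg (y 0)) (hρ _ (abs_nonneg (y 0)))]
  rcases lt_trichotomy (y 0) 0 with h | h | h
  · rw [abs_of_neg h, neg_div, errorFunction_neg]
    have := h.ne
    field_simp
  · simp [h, errorFunction]
  · rw [abs_of_pos h, div_mul_cancel₀ _ h.ne']

theorem cubeToSphere_one {ρ : ℝ → ℝ} (hρ : ∀ r : ℝ, 0 ≤ r → IsSphereRadius 1 r (ρ r))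
    (x : openCube 1) : (cubeToSphere 1 ρ x : EuclideanSpace ℝ (Fin 2)) =
      !₂[-Real.sin (2 * Real.pi * x.1 0), -Real.cos (2 * Real.pi * x.1 0)] := by
  rw [cubeToSphere, Function.comp, Function.comp, sphereExp_one, radialMap_one_apply hρ,
    cubeToEuclidean_apply, errorFunction_normalQuantile (x.2 0),
    show Real.pi * (2 * x.1 0 - 1) = 2 * Real.pi * x.1 0 - Real.pi by ring,
    Real.sin_sub_pi, Real.cos_sub_pi]

theorem radialGaussianIntegral_two (r : ℝ) :
    radialGaussianIntegral 2 r = 1 - Real.exp (-r ^ 2 / 2) := by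
  have h : ∀ t : ℝ, HasDerivAt (fun t : ℝ => -Real.exp (-t ^ 2 / 2))
      (t ^ (2 - 1) * Real.exp (-t ^ 2 / 2)) t := by
    intro t
    have := (((hasDerivAt_pow 2 t).neg.div_const 2).exp).neg
    refine this.congr_deriv ?_
    simp
    ring
  rw [radialGaussianIntegral, intervalIntegral.integral_eq_sub_of_hasDerivAt (fun t _ => h t)
    (Continuous.intervalIntegrable (by fun_prop) _ _)]
  simp
  ring

/-- For n = 2 both integrals are elementary and the radial equation reads 1 - cos s = 2(1 -
e^(-r²/2)). -/
theorem cos_sphereRadius_two {r s : ℝ} (hr : 0 ≤ r) (h : IsSphereRadius 2 r s) :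
    Real.cos s = 2 * Real.exp (-r ^ 2 / 2) - 1 := by
  have h' := ((isSphereRadius_iff (by norm_num) hr s).1 h).2
  have hG : Real.Gamma (((2 : ℕ) + 1) / 2) = 1 / 2 * Real.sqrt Real.pi := by
    rw [show (((2 : ℕ) : ℝ) + 1) / 2 = 1 / 2 + 1 by norm_num, Real.Gamma_add_one (by norm_num),
      Real.Gamma_one_half_eq]
  have hpi := (Real.sqrt_pos.2 Real.pi_pos).ne'
  have hK : radialFactor 2 = 2 := by
    rw [radialFactor, hG, show (1 : ℝ) - (2 : ℕ) / 2 = 0 by norm_num, Real.rpow_zero]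
    field_simp
  rw [hK, radialGaussianIntegral_two, sinPowIntegral] at h'
  simp only [Nat.add_one_sub_one, pow_one, integral_sin, Real.cos_zero] at h'
  linarith

theorem sphereRadius_two {r s : ℝ} (hr : 0 ≤ r) (h : IsSphereRadius 2 r s) :
    s = 2 * Real.arccos (Real.exp (-r ^ 2 / 4)) := by
  have hu := Real.exp_pos (-r ^ 2 / 4)
  have hu1 : Real.exp (-r ^ 2 / 4) ≤ 1 := Real.exp_le_one_iff.2 (by nlinarith)
  have ha := Real.arccos_le_pi_div_two.2 hu.le
  have ha0 := Real.arccos_nonneg (Real.exp (-r ^ 2 / 4))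
  -- Since 0 < e^(-r²/4), its arccosine is at most π/2, so both angles lie in [0, π], and the
  -- double-angle formula compares their cosines.
  refine Real.injOn_cos (Ico_subset_Icc_self h.1) ⟨by linarith, by linarith⟩ ?_
  rw [cos_sphereRadius_two hr h, Real.cos_two_mul, Real.cos_arccos (by linarith) hu1,
    ← Real.exp_nat_mul]
  congr 3
  push_cast
  ring

theorem sin_sphereRadius_two {r s : ℝ} (hr : 0 ≤ r) (h : IsSphereRadius 2 r s) :
    Real.sin s = 2 * Real.exp (-r ^ 2 / 4) * Real.sqrt (1 - Real.exp (-r ^ 2 / 2)) := by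
  have hu := Real.exp_pos (-r ^ 2 / 4)
  have hu1 : Real.exp (-r ^ 2 / 4) ≤ 1 := Real.exp_le_one_iff.2 (by nlinarith)
  have hsq : Real.exp (-r ^ 2 / 4) ^ 2 = Real.exp (-r ^ 2 / 2) := by
    rw [← Real.exp_nat_mul]
    congr 1
    push_cast
    ring
  rw [sphereRadius_two hr h, Real.sin_two_mul, Real.cos_arccos (by linarith) hu1,
    Real.sin_arccos, hsq]
  ring

theorem sphereExp_radialMap_castSucc {n : ℕ} (hn : 1 ≤ n) {ρ : ℝ → ℝ}
    (hρ : ∀ r : ℝ, 0 ≤ r → IsSphereRadius n r (ρ r)) (y : EuclideanSpace ℝ (Fin n)) (i : Fin n) :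
    (sphereExp n (radialMap n ρ y)).1 i.castSucc = y i / ‖y‖ * Real.sin (ρ ‖y‖) := by
  rw [sphereExp_castSucc, norm_radialMap hn hρ, radialMap, PiLp.smul_apply, smul_eq_mul]
  by_cases hy : y = 0
  · simp [hy]
  · have hy0 := norm_pos_iff.2 hy
    have := sphereRadius_pos hn hρ hy0
    field_simp

theorem cubeToSphere_two {ρ : ℝ → ℝ} (hρ : ∀ r : ℝ, 0 ≤ r → IsSphereRadius 2 r (ρ r))
    (x : openCube 2) {y : EuclideanSpace ℝ (Fin 2)} (hy : y = cubeToEuclidean 2 x) :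
    (cubeToSphere 2 ρ x : EuclideanSpace ℝ (Fin 3)) =
      !₂[y 0 / ‖y‖ * (2 * Real.exp (-‖y‖ ^ 2 / 4) * Real.sqrt (1 - Real.exp (-‖y‖ ^ 2 / 2))),
        y 1 / ‖y‖ * (2 * Real.exp (-‖y‖ ^ 2 / 4) * Real.sqrt (1 - Real.exp (-‖y‖ ^ 2 / 2))),
        2 * Real.exp (-‖y‖ ^ 2 / 2) - 1] := by
  have hr := norm_nonneg y
  rw [cubeToSphere, Function.comp, Function.comp, ← hy, ← sin_sphereRadius_two hr (hρ _ hr),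
    ← cos_sphereRadius_two hr (hρ _ hr)]
  ext i
  refine Fin.lastCases ?_ (fun j => ?_) i
  · rw [sphereExp_last, norm_radialMap (by norm_num) hρ]
    rfl
  · rw [sphereExp_radialMap_castSucc (by norm_num) hρ]
    fin_cases j <;> rfl

end

theorem corollary3p1 :
    -- general dimension
    (∀ n : ℕ, 1 ≤ n →
      (∀ r : ℝ, 0 ≤ r → ∃! s : ℝ, IsSphereRadius n r s) ∧
      ∀ ρ : ℝ → ℝ, (∀ r : ℝ, 0 ≤ r → IsSphereRadius n r (ρ r)) →
        IsMeasurePreservingOnto (radialMap n ρ) (normalMeasure n 1)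
          (radialMeasure n Real.pi fun s => sphereVolumeDensity n s / sphereVolume n)
          (Metric.ball 0 Real.pi) ∧
        IsMeasurePreservingOnto (cubeToSphere n ρ) (cubeUniform n) (sphereUniform n) {southPole n}ᶜ) ∧
    -- the circle
    (∀ ρ : ℝ → ℝ, (∀ r : ℝ, 0 ≤ r → IsSphereRadius 1 r (ρ r)) →
      (∀ r : ℝ, 0 ≤ r →
        ρ r = Real.sqrt Real.pi * lowerIncompleteGamma (1 / 2) (r ^ 2 / 2) ∧
        ρ r = Real.pi * errorFunction (r / Real.sqrt 2)) ∧
      ∀ x : openCube 1,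
        (cubeToSphere 1 ρ x : EuclideanSpace ℝ (Fin 2)) =
          !₂[-Real.sin (2 * Real.pi * x.1 0), -Real.cos (2 * Real.pi * x.1 0)] ∧
        (((cubeToSphere 1 ρ x).1 0 : ℝ) : ℂ) + (((cubeToSphere 1 ρ x).1 1 : ℝ) : ℂ) * Complex.I =
          -Complex.I * Complex.exp (-(Complex.I * 2 * (Real.pi : ℂ) * ((x.1 0 : ℝ) : ℂ)))) ∧
    -- the two-dimensional sphere
    (∀ ρ : ℝ → ℝ, (∀ r : ℝ, 0 ≤ r → IsSphereRadius 2 r (ρ r)) →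
      (∀ r : ℝ, 0 ≤ r → ρ r = 2 * Real.arccos (Real.exp (-r ^ 2 / 4))) ∧
      ∀ x : openCube 2, ∀ y : EuclideanSpace ℝ (Fin 2), y = cubeToEuclidean 2 x →
        (cubeToSphere 2 ρ x : EuclideanSpace ℝ (Fin 3)) =
          !₂[y 0 / ‖y‖ * (2 * Real.exp (-‖y‖ ^ 2 / 4) * Real.sqrt (1 - Real.exp (-‖y‖ ^ 2 / 2))),
            y 1 / ‖y‖ * (2 * Real.exp (-‖y‖ ^ 2 / 4) * Real.sqrt (1 - Real.exp (-‖y‖ ^ 2 / 2))),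
            2 * Real.exp (-‖y‖ ^ 2 / 2) - 1]) := by
  refine ⟨fun n hn => ⟨fun r hr => existsUnique_isSphereRadius hn hr, fun ρ hρ =>
    ⟨isMeasurePreservingOnto_radialMap hn hρ, isMeasurePreservingOnto_cubeToSphere hn hρ⟩⟩,
    fun ρ hρ => ⟨fun r hr => ?_, fun x => ?_⟩,
    fun ρ hρ => ⟨fun r hr => sphereRadius_two hr (hρ r hr),
      fun x y hy => cubeToSphere_two hρ x hy⟩⟩
  · have h := sphereRadius_one hr (hρ r hr)
    exact ⟨h.trans (sqrt_pi_mul_lowerIncompleteGamma_half hr).symm, h⟩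
  · have h := cubeToSphere_one hρ x
    refine ⟨h, ?_⟩
    have h0 : (cubeToSphere 1 ρ x).1 0 = -Real.sin (2 * Real.pi * x.1 0) := by rw [h]; rfl
    have h1 : (cubeToSphere 1 ρ x).1 1 = -Real.cos (2 * Real.pi * x.1 0) := by rw [h]; rfl
    have e : -(Complex.I * 2 * (Real.pi : ℂ) * ((x.1 0 : ℝ) : ℂ)) =
        ((-(2 * Real.pi * x.1 0) : ℝ) : ℂ) * Complex.I := by
      push_cast
      ring
    rw [h0, h1, e, Complex.exp_mul_I, ← Complex.ofReal_cos, ← Complex.ofReal_sin, Real.cos_neg,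
      Real.sin_neg]
    push_cast
    linear_combination -Complex.sin (2 * Real.pi * x.1 0) * Complex.I_mul_I
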